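/- Fix an integer $r\ge 1$ and let $V=\mathbb{R}^r$ with the standard inner product $\langle\cdot,\cdot\rangle$. Let $\Lambda$ be a finite set of pairs $f=(\vec f,c_f)$ with $\vec f\in\mathbb{Z}^r\setminus\{0\}$ and $c_f\in\mathbb{C}$, regarded as affine functionals $f(\mathbf v)=\langle\vec f,\mathbf v\rangle+c_f$. For $X\subset\Lambda$ let $\langle\vec X\rangle=\sum_{f\in X}\mathbb{Z}\vec f$ and $\mathfrak H_X=\sum_{f\in X}\mathbb{R}\vec f$. Assume that $\langle\vec\Lambda\rangle$ has rank $r$, and let $\widetilde\Lambda$ be the set of those $f\in\Lambda$ for which the lattice generated by the vectors $\vec g$, $g\in\Lambda\setminus\{f\}$, has rank different from $r$. For $\mathbf k=(k_f)_{f\in\Lambda}$ with $k_f\in\mathbb{Z}_{\ge 0}$ put $\Lambda_j=\{f\in\Lambda: k_f=j\}$ and $\Lambda_+=\{f\in\Lambda:k_f>0\}$. For $\mathbf y\in V\setminus\bigcup_{f\in\widetilde\Lambda\cap\Lambda_1}(\mathfrak H_{\Lambda\setminus\{f\}}+\mathbb{Z}^r)$ define $$S(\mathbf k,\mathbf y;\Lambda)=\lim_{N\to\infty}(-1)^{\sharp\Lambda_0}\sum_{\substack{\mathbf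 v\in\mathbb{Z}^r,\ |v_j|\le N\ (1\le j\le r)\\ f(\mathbf v)\ne 0\ (f\in\Lambda_+)\\ f(\mathbf v)=0\ (f\in\Lambda_0)}}e^{2\pi i\langle\mathbf y,\mathbf v\rangle}\prod_{f\in\Lambda_+}\frac1{f(\mathbf v)^{k_f}}.$$ Let $\mathscr B$ be the set of all $B\subset\Lambda$ with $r$ elements such that $\{\vec f: f\in B\}$ is a basis of $V$, and for $B\in\mathscr B$ let $(\vec f^{\,B})_{f\in B}$ be the dual basis in $V$ (so $\langle\vec g,\vec f^{\,B}\rangle=\delta_{g,f}$ for $f,g\in B$). Fix $\phi\in V$ that lies in no $\mathfrak H_R$, where $R$ runs over the $(r-1)$-element subsets of $\Lambda$ whose vectors $\vec g$, $g\in R$, are linearly independent; then $\langle\phi,\vec f^{\,B}\rangle\ne0$ for all $B\in\mathscr B$, $f\in B$. With $\{a\}=a-\lfloor a\rfloor$ for real $a$, put $$\{\mathbf y\}_{B,f}=\begin{cases}\{\langle\mathbf y,\vec f^{\,B}\rangle\}&\text{if }\langle\phi,\vec f^{\,B}\rangle>0,\\ 1-\{-\langle\mathbf y,\vec f^{\,B}\rangle\}&\text{if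 }\langle\phi,\vec f^{\,B}\rangle<0.\end{cases}$$ For $k\in\mathbb{Z}_{\ge0}$, $x\in\mathbb{R}$, $b\in\mathbb{C}$, the coefficients $C(k,x;b)$ are defined by the expansion, for all sufficiently small $t\neq 0$, $$\frac{t\,e^{(t-2\pi i b)x}}{e^{t-2\pi i b}-1}=\sum_{k=0}^\infty C(k,x;b)\frac{t^k}{k!}.$$ **Proposition.** For all $\mathbf k$ and $\mathbf y$ as above, the limit defining $S(\mathbf k,\mathbf y;\Lambda)$ exists. Moreover, for every decomposition $\Lambda=B_0\sqcup L_0$ with $B_0\in\mathscr B$, $$S(\mathbf k,\mathbf y;\Lambda)=\frac1{\sharp(\mathbb{Z}^r/\langle\vec B_0\rangle)}\prod_{f\in\Lambda}\Bigl(-\frac{(2\pi i)^{k_f}}{k_f!}\Bigr)\sum_{\mathbf w\in\mathbb{Z}^r/\langle\vec B_0\rangle}\int_{[0,1]^{L_0}}\Bigl(\prod_{g\in L_0}C(k_g,x_g;c_g)\Bigr)\prod_{f\in B_0}C\Bigl(k_f,\bigl\{\mathbf y+\mathbf w-\textstyle\sum_{g\in L_0}x_g\vec g\bigr\}_{B_0,f};c_f\Bigr)\,\prod_{g\in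 L_0}dx_g,$$ where all the integrands are integrable on $[0,1]^{L_0}$. -/

import Mathlib

open Filter Topology MeasureTheory

namespace LatticeSum

/-- An affine functional `f = (vec f, const f)` on `ℝ^r`, with integral linear part `f.1`
and complex constant `f.2`. -/
abbrev Functional (r : ℕ) : Type := (Fin r → ℤ) × ℂ

/-- An integral vector regarded as a vector of `V = ℝ^r`. -/
def toV {r : ℕ} (v : Fin r → ℤ) : Fin r → ℝ := fun i => (v i : ℝ)

/-- The value `f(v) = ⟨vec f, v⟩ + const f` at a lattice point `v`. -/
def value {r : ℕ} (f : Functional r) (v : Fin r → ℤ) : ℂ := ((f.1 ⬝ᵥ v : ℤ) : ℂ) + f.2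

/-- The lattice `⟨vec X⟩ = ∑_{f ∈ X} ℤ (vec f)`. -/
def lattice {r : ℕ} (X : Finset (Functional r)) : Submodule ℤ (Fin r → ℤ) :=
  Submodule.span ℤ (Prod.fst '' (X : Set (Functional r)))

/-- The rank of the lattice `⟨vec X⟩`. -/
noncomputable def latticeRank {r : ℕ} (X : Finset (Functional r)) : ℕ :=
  Module.finrank ℤ (lattice X)

/-- The real subspace `𝔥_X = ∑_{f ∈ X} ℝ (vec f)`. -/
def realSpan {r : ℕ} (X : Finset (Functional r)) : Submodule ℝ (Fin r → ℝ) :=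
  Submodule.span ℝ ((fun f : Functional r => toV f.1) '' (X : Set (Functional r)))

/-- The set `𝔥_X + ℤ^r`. -/
def realSpanTranslates {r : ℕ} (X : Finset (Functional r)) : Set (Fin r → ℝ) :=
  {y | ∃ h ∈ realSpan X, ∃ w : Fin r → ℤ, y = h + toV w}

/-- The set `Λ~` of indispensable elements: those `f ∈ Λ` such that the linear parts of the
other elements of `Λ` do not span a lattice of rank `r`. -/
noncomputable def indispensable {r : ℕ} (Λ : Finset (Functional r)) : Finset (Functional r) :=
  Λ.filter (fun f => latticeRank (Λ.erase f) ≠ r)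

/-- The truncated lattice sum `Z(N; k, y; Λ)`. -/
noncomputable def Z {r : ℕ} (Λ : Finset (Functional r)) (k : Functional r → ℕ)
    (y : Fin r → ℝ) (N : ℕ) : ℂ :=
  (-1) ^ (Λ.filter (fun f => k f = 0)).card *
    ∑ v ∈ (Fintype.piFinset (fun _ : Fin r => Finset.Icc (-(N : ℤ)) (N : ℤ))).filter
        (fun v => (∀ f ∈ Λ, 0 < k f → value f v ≠ 0) ∧ (∀ f ∈ Λ, k f = 0 → value f v = 0)),
      Complex.exp (2 * Real.pi * Complex.I * ((y ⬝ᵥ toV v : ℝ) : ℂ)) *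
        ∏ f ∈ Λ.filter (fun f => 0 < k f), 1 / value f v ^ k f

/-- The lattice sum `S(k, y; Λ) = lim_{N → ∞} Z(N; k, y; Λ)`. -/
noncomputable def S {r : ℕ} (Λ : Finset (Functional r)) (k : Functional r → ℕ)
    (y : Fin r → ℝ) : ℂ :=
  limUnder atTop (Z Λ k y)

/-- `B ∈ 𝓑(Λ)`: `B ⊆ Λ` and the vectors `vec f`, `f ∈ B`, form a basis of `V = ℝ^r`. -/
structure IsBasisOf {r : ℕ} (Λ B : Finset (Functional r)) : Prop where
  subset : B ⊆ Λ
  linearIndependent : LinearIndependent ℝ (fun f : B => toV f.1.1)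
  span_eq_top : realSpan B = ⊤

/-- `R ∈ 𝓡(Λ)`: `R ⊆ Λ` has `r - 1` elements, with linearly independent linear parts. -/
structure IsIndepOfCorank1 {r : ℕ} (Λ R : Finset (Functional r)) : Prop where
  subset : R ⊆ Λ
  card_add_one : R.card + 1 = r
  linearIndependent : LinearIndependent ℝ (fun f : R => toV f.1.1)

/-- The vector `f^B` of the dual basis of `vec B`: the vector `u` with `⟨vec f, u⟩ = 1` and
`⟨vec g, u⟩ = 0` for the other `g ∈ B`. It exists and is unique if `vec B` is a basis of `V`
and `f ∈ B`. -/
noncomputable def dualVec {r : ℕ} (B : Finset (Functional r)) (f : Functional r) : Fin r → ℝ :=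
  Classical.epsilon (fun u => ∀ g ∈ B, toV g.1 ⬝ᵥ u = if g = f then 1 else 0)

theorem dualVec_spec {r : ℕ} {Λ B : Finset (Functional r)} (h : IsBasisOf Λ B)
    (f : Functional r) {g : Functional r} (hg : g ∈ B) :
    toV g.1 ⬝ᵥ dualVec B f = if g = f then 1 else 0 := by
  have hsp : ⊤ ≤ Submodule.span ℝ (Set.range (fun f : B => toV f.1.1)) := by
    rw [← h.span_eq_top, realSpan]
    apply Submodule.span_mono
    rintro _ ⟨a, ha, rfl⟩
    exact ⟨⟨a, ha⟩, rfl⟩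
  let b := Module.Basis.mk h.linearIndependent hsp
  let ℓ : (Fin r → ℝ) →ₗ[ℝ] ℝ := b.constr ℝ (fun a : B => if a.1 = f then (1 : ℝ) else 0)
  have hex : ∃ u : Fin r → ℝ, ∀ g ∈ B, toV g.1 ⬝ᵥ u = if g = f then 1 else 0 := by
    refine ⟨fun i => ℓ (Pi.single i 1), fun g hg => ?_⟩
    have h1 : ℓ (b ⟨g, hg⟩) = if g = f then 1 else 0 := by
      simp only [ℓ]
      rw [Module.Basis.constr_basis]
    have h2 : b ⟨g, hg⟩ = toV g.1 := by simp [b]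
    rw [← h1, h2, LinearMap.pi_apply_eq_sum_univ ℓ (toV g.1)]
    simp only [dotProduct, smul_eq_mul]
    refine Finset.sum_congr rfl fun i _ => ?_
    congr 2
    ext j
    simp [Pi.single_apply, eq_comm]
  exact Classical.epsilon_spec hex g hg

/-- The multi-dimensional fractional part `{y}_{B,f}`, relative to the vector `φ`. -/
noncomputable def frac {r : ℕ} (φ : Fin r → ℝ) (B : Finset (Functional r)) (f : Functional r)
    (y : Fin r → ℝ) : ℝ :=
  if 0 < φ ⬝ᵥ dualVec B f then Int.fract (y ⬝ᵥ dualVec B f)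
  else 1 - Int.fract (-(y ⬝ᵥ dualVec B f))

theorem dualVec_lattice {r : ℕ} {Λ B : Finset (Functional r)} (h : IsBasisOf Λ B)
    (f : Functional r) {w : Fin r → ℤ} (hw : w ∈ lattice B) :
    ∃ n : ℤ, toV w ⬝ᵥ dualVec B f = n := by
  induction hw using Submodule.span_induction with
  | mem x hx =>
    obtain ⟨g, hg, rfl⟩ := hx
    rw [dualVec_spec h f hg]
    split_ifs
    · exact ⟨1, by simp⟩
    · exact ⟨0, by simp⟩
  | zero => exact ⟨0, by simp [toV, dotProduct]⟩
  | add x z _ _ hx hz =>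
    obtain ⟨m, hm⟩ := hx
    obtain ⟨n, hn⟩ := hz
    refine ⟨m + n, ?_⟩
    have : toV (x + z) = toV x + toV z := by ext i; simp [toV]
    rw [this, add_dotProduct, hm, hn]
    push_cast
    rfl
  | smul a x _ hx =>
    obtain ⟨m, hm⟩ := hx
    refine ⟨a * m, ?_⟩
    have : toV (a • x) = (a : ℝ) • toV x := by ext i; simp [toV]
    rw [this, smul_dotProduct, hm]
    push_cast
    rfl

theorem frac_congr {r : ℕ} {Λ B : Finset (Functional r)} (h : IsBasisOf Λ B)
    (φ : Fin r → ℝ) (f : Functional r) (y : Fin r → ℝ) {v w : Fin r → ℤ}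
    (hvw : v - w ∈ lattice B) : frac φ B f (y + toV v) = frac φ B f (y + toV w) := by
  obtain ⟨n, hn⟩ := dualVec_lattice h f hvw
  have hv : toV v = toV w + toV (v - w) := by ext i; simp [toV]
  have key : (y + toV v) ⬝ᵥ dualVec B f = (y + toV w) ⬝ᵥ dualVec B f + n := by
    rw [hv, ← add_assoc, add_dotProduct, hn]
  have key' : -((y + toV w) ⬝ᵥ dualVec B f + n) = -((y + toV w) ⬝ᵥ dualVec B f) - n := by ring
  unfold frac
  rw [key, Int.fract_add_intCast, key', Int.fract_sub_intCast]

/-- `{y + w}_{B,f}` for a class `w ∈ ℤ^r / ⟨vec B⟩`. -/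
noncomputable def fracCoset {r : ℕ} {Λ B : Finset (Functional r)} (h : IsBasisOf Λ B)
    (φ : Fin r → ℝ) (f : Functional r) (y : Fin r → ℝ) (w : (Fin r → ℤ) ⧸ lattice B) : ℝ :=
  Quotient.liftOn' w (fun v => frac φ B f (y + toV v)) (fun _ _ hab =>
    frac_congr h φ f y ((Submodule.quotientRel_def _).1 hab))

/-- The function `F(t, y; b) = t e^{(t - 2πib)y} / (e^{t - 2πib} - 1)` of `t`. -/
noncomputable def genFun (y : ℝ) (b : ℂ) (t : ℂ) : ℂ :=
  t * Complex.exp ((t - 2 * Real.pi * Complex.I * b) * y) /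
    (Complex.exp (t - 2 * Real.pi * Complex.I * b) - 1)

/-- The coefficient `C(k, y; b)` in `F(t, y; b) = ∑_k C(k, y; b) t^k / k!`, that is, the `k`-th
derivative at `t = 0` of `F(·, y; b)`, whose removable singularity at `t = 0` (present when `b`
is an integer) is filled in by the limit. -/
noncomputable def C (k : ℕ) (y : ℝ) (b : ℂ) : ℂ :=
  iteratedDeriv k (Function.update (genFun y b) 0 (limUnder (𝓝[≠] 0) (genFun y b))) 0

theorem exists_tendsto_genFun (y : ℝ) (b : ℂ) :
    ∃ l, Tendsto (genFun y b) (𝓝[≠] 0) (𝓝 l) := by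
  set a : ℂ := 2 * Real.pi * Complex.I * b with ha
  have hnum : ContinuousAt (fun t : ℂ => Complex.exp ((t - a) * y)) 0 := by fun_prop
  by_cases h1 : Complex.exp (-a) = 1
  · have hd : HasDerivAt (fun t : ℂ => Complex.exp (t - a)) 1 0 := by
      have := ((hasDerivAt_id (0 : ℂ)).sub_const a).cexp
      simpa [h1] using this
    have hs := (hd.tendsto_slope).inv₀ one_ne_zero
    refine ⟨_, ((hnum.tendsto.mono_left nhdsWithin_le_nhds).mul hs).congr' ?_⟩
    filter_upwards [self_mem_nhdsWithin] with t ht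
    simp only [genFun, slope_def_field, zero_sub, h1, sub_zero, ← ha]
    rw [inv_div]
    ring
  · refine ⟨_, (ContinuousAt.tendsto (f := genFun y b) (x := 0) ?_).mono_left
      nhdsWithin_le_nhds⟩
    unfold genFun
    refine ContinuousAt.div (by fun_prop) (by fun_prop) ?_
    rw [← ha, zero_sub]
    exact sub_ne_zero.2 h1

/-- The defining expansion `F(t, y; b) = ∑_k C(k, y; b) t^k / k!` for all small `t ≠ 0`. -/
theorem hasSum_C (y : ℝ) (b : ℂ) :
    ∀ᶠ t in 𝓝[≠] (0 : ℂ),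
      HasSum (fun n : ℕ => C n y b * (t ^ n / (n.factorial : ℂ))) (genFun y b t) := by
  set a : ℂ := 2 * Real.pi * Complex.I * b with ha
  set G := Function.update (genFun y b) 0 (limUnder (𝓝[≠] 0) (genFun y b)) with hG
  have hne : ∀ᶠ t in 𝓝[≠] (0 : ℂ), Complex.exp (t - a) - 1 ≠ 0 := by
    by_cases h1 : Complex.exp (-a) = 1
    · have hd : HasDerivAt (fun t : ℂ => Complex.exp (t - a)) 1 0 := by
        have := ((hasDerivAt_id (0 : ℂ)).sub_const a).cexp
        simpa [h1] using this
      filter_upwards [hd.eventually_ne one_ne_zero (c := 1)] with t ht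
      exact sub_ne_zero.2 ht
    · have hc : ContinuousAt (fun t : ℂ => Complex.exp (t - a) - 1) 0 := by fun_prop
      exact (hc.eventually_ne (by simpa using sub_ne_zero.2 h1)).filter_mono nhdsWithin_le_nhds
  have hGeq : ∀ t : ℂ, t ≠ 0 → G =ᶠ[𝓝 t] genFun y b := by
    intro t ht
    filter_upwards [isOpen_ne.mem_nhds ht] with s hs
    exact Function.update_of_ne hs _ _
  have hdiff : ∀ᶠ t in 𝓝[≠] (0 : ℂ), DifferentiableAt ℂ G t := by
    filter_upwards [hne, self_mem_nhdsWithin] with t ht ht0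
    refine DifferentiableAt.congr_of_eventuallyEq ?_ (hGeq t ht0)
    unfold genFun
    exact DifferentiableAt.div (by fun_prop) (by fun_prop) ht
  have hcont : ContinuousAt G 0 :=
    continuousAt_update_same.2 (tendsto_nhds_limUnder (exists_tendsto_genFun y b))
  obtain ⟨R, hR, hball⟩ := Metric.eventually_nhds_iff_ball.1
    ((Complex.analyticAt_of_differentiable_on_punctured_nhds_of_continuousAt
      hdiff hcont).eventually_analyticAt)
  have hD : DifferentiableOn ℂ G (Metric.ball 0 R) := fun t ht =>
    (hball t ht).differentiableAt.differentiableWithinAt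
  filter_upwards [nhdsWithin_le_nhds (Metric.ball_mem_nhds (0 : ℂ) hR), self_mem_nhdsWithin]
    with t ht ht0
  have hsum := Complex.hasSum_taylorSeries_on_ball hD ht
  rw [(hGeq t ht0).self_of_nhds] at hsum
  refine hsum.congr_fun fun n => ?_
  simp only [C, ← hG, smul_eq_mul, sub_zero]
  ring

/-- The integrand of the evaluation formula, for a class `w ∈ ℤ^r / ⟨vec B⟩`, as a function of
`x = (x_g)_{g ∈ L}`. -/
noncomputable def integrand {r : ℕ} {Λ B : Finset (Functional r)} (h : IsBasisOf Λ B)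
    (L : Finset (Functional r)) (φ : Fin r → ℝ) (k : Functional r → ℕ) (y : Fin r → ℝ)
    (w : (Fin r → ℤ) ⧸ lattice B) (x : L → ℝ) : ℂ :=
  (∏ g : L, C (k g) (x g) g.1.2) *
    ∏ f ∈ B, C (k f) (fracCoset h φ f (y - ∑ g : L, x g • toV g.1.1) w) f.2

end LatticeSum

namespace LatticeSum

/-- `F(·, y; b)` with its removable singularity at `0` filled in. -/
noncomputable def genFunFilled (y : ℝ) (b : ℂ) : ℂ → ℂ :=
  Function.update (genFun y b) 0 (limUnder (𝓝[≠] 0) (genFun y b))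

theorem exp_sub_one_ne_zero_eventually (a : ℂ) :
    ∀ᶠ t in 𝓝[≠] (0 : ℂ), Complex.exp (t - a) - 1 ≠ 0 := by
  by_cases h1 : Complex.exp (-a) = 1
  · have hd : HasDerivAt (fun t : ℂ => Complex.exp (t - a)) 1 0 := by
      have := ((hasDerivAt_id (0 : ℂ)).sub_const a).cexp
      simpa [h1] using this
    filter_upwards [hd.eventually_ne one_ne_zero (c := 1)] with t ht
    exact sub_ne_zero.2 ht
  · have hc : ContinuousAt (fun t : ℂ => Complex.exp (t - a) - 1) 0 := by fun_prop
    exact (hc.eventually_ne (by simpa using sub_ne_zero.2 h1)).filter_mono nhdsWithin_le_nhds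

theorem genFunFilled_of_ne (y : ℝ) (b : ℂ) {t : ℂ} (ht : t ≠ 0) :
    genFunFilled y b t = genFun y b t :=
  Function.update_of_ne ht _ _

theorem analyticAt_genFunFilled (y : ℝ) (b : ℂ) : AnalyticAt ℂ (genFunFilled y b) 0 := by
  refine Complex.analyticAt_of_differentiable_on_punctured_nhds_of_continuousAt ?_
    (continuousAt_update_same.2 (tendsto_nhds_limUnder (exists_tendsto_genFun y b)))
  filter_upwards [exp_sub_one_ne_zero_eventually (2 * Real.pi * Complex.I * b),
    self_mem_nhdsWithin] with t ht ht0
  have : genFunFilled y b =ᶠ[𝓝 t] genFun y b := by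
    filter_upwards [isOpen_ne.mem_nhds ht0] with s hs
    exact genFunFilled_of_ne y b hs
  refine DifferentiableAt.congr_of_eventuallyEq ?_ this
  unfold genFun
  exact DifferentiableAt.div (by fun_prop) (by fun_prop) ht

/-- Two functions continuous at `0` that agree near `0` off `0` agree near `0`. -/
theorem eventuallyEq_nhds_of_punctured {f g : ℂ → ℂ} (hf : ContinuousAt f 0)
    (hg : ContinuousAt g 0) (h : f =ᶠ[𝓝[≠] 0] g) : f =ᶠ[𝓝 0] g := by
  have h0 : f 0 = g 0 :=
    tendsto_nhds_unique ((hf.tendsto.mono_left nhdsWithin_le_nhds).congr' h)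
      (hg.tendsto.mono_left nhdsWithin_le_nhds)
  rw [EventuallyEq, eventually_nhdsWithin_iff] at h
  filter_upwards [h] with t ht
  by_cases h1 : t = 0
  · rw [h1, h0]
  · exact ht h1

theorem genFunFilled_eventuallyEq (y : ℝ) (b : ℂ) :
    genFunFilled y b =ᶠ[𝓝 0] fun t =>
      genFunFilled 0 b t * (Complex.exp (y * t) *
        Complex.exp (-(2 * Real.pi * Complex.I * b) * y)) := by
  refine eventuallyEq_nhds_of_punctured (analyticAt_genFunFilled y b).continuousAt
    ((analyticAt_genFunFilled 0 b).continuousAt.mul (by fun_prop)) ?_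
  filter_upwards [self_mem_nhdsWithin] with t ht
  rw [genFunFilled_of_ne y b ht, genFunFilled_of_ne 0 b ht, genFun, genFun, ← Complex.exp_add]
  simp only [Complex.ofReal_zero, mul_zero, Complex.exp_zero, mul_one]
  rw [div_mul_eq_mul_div]
  congr 3
  ring

/-- `C(k, y; b)` is `e^{-2πiby}` times an Appell polynomial in `y`. -/
theorem C_eq_sum (k : ℕ) (y : ℝ) (b : ℂ) :
    C k y b = ∑ i ∈ Finset.range (k + 1), (k.choose i : ℂ) * C i 0 b *
      ((y : ℂ) ^ (k - i) * Complex.exp (-(2 * Real.pi * Complex.I * b) * y)) := by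
  have h1 : C k y b = iteratedDeriv k (genFunFilled y b) 0 := rfl
  rw [h1, (genFunFilled_eventuallyEq y b).iteratedDeriv_eq k, iteratedDeriv_fun_mul
    (analyticAt_genFunFilled 0 b).contDiffAt (by fun_prop)]
  refine Finset.sum_congr rfl fun i _ => ?_
  congr 1
  have : ∀ n : ℕ, iteratedDeriv n (fun t : ℂ => Complex.exp (y * t) *
      Complex.exp (-(2 * Real.pi * Complex.I * b) * y)) 0 =
      (y : ℂ) ^ n * Complex.exp (-(2 * Real.pi * Complex.I * b) * y) := by
    intro n
    rw [funext fun t : ℂ => mul_comm (Complex.exp (y * t)) _, iteratedDeriv_const_mul_field, iteratedDeriv_cexp_const_mul]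
    simp [mul_comm]
  exact this _

theorem C_one_sub_C_zero (k : ℕ) (b : ℂ) :
    C k 1 b - C k 0 b = if k = 1 then 1 else 0 := by
  have h1 : (genFunFilled 1 b - genFunFilled 0 b) =ᶠ[𝓝 0] fun t => t := by
    refine eventuallyEq_nhds_of_punctured ((analyticAt_genFunFilled 1 b).continuousAt.sub
      (analyticAt_genFunFilled 0 b).continuousAt) (by fun_prop) ?_
    filter_upwards [exp_sub_one_ne_zero_eventually (2 * Real.pi * Complex.I * b),
      self_mem_nhdsWithin] with t ht ht0
    rw [Pi.sub_apply, genFunFilled_of_ne _ b ht0, genFunFilled_of_ne 0 b ht0, genFun, genFun,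
      ← sub_div, ← mul_sub]
    simp only [Complex.ofReal_one, Complex.ofReal_zero, mul_zero, Complex.exp_zero, mul_one]
    exact mul_div_cancel_right₀ _ ht
  have h2 : C k 1 b - C k 0 b = iteratedDeriv k (genFunFilled 1 b - genFunFilled 0 b) 0 := by
    rw [iteratedDeriv_sub (analyticAt_genFunFilled 1 b).contDiffAt
      (analyticAt_genFunFilled 0 b).contDiffAt]
    rfl
  rw [h2, h1.iteratedDeriv_eq k]
  rcases k with _ | _ | k
  · simp
  · simp
  · rw [iteratedDeriv_succ', iteratedDeriv_succ']
    simp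

theorem continuous_C (k : ℕ) (b : ℂ) : Continuous fun x : ℝ => C k x b := by
  rw [funext fun x => C_eq_sum k x b]
  fun_prop

theorem hasDerivAt_C (k : ℕ) (b : ℂ) (x : ℝ) :
    HasDerivAt (fun x : ℝ => C k x b)
      (k * C (k - 1) x b - 2 * Real.pi * Complex.I * b * C k x b) x := by
  have hE : HasDerivAt (fun x : ℝ => Complex.exp (-(2 * Real.pi * Complex.I * b) * x))
      (Complex.exp (-(2 * Real.pi * Complex.I * b) * x) * (-(2 * Real.pi * Complex.I * b))) x := by
    have := ((hasDerivAt_id (x : ℂ)).const_mul (-(2 * Real.pi * Complex.I * b))).cexp.comp_ofReal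
    simpa using this
  have hP : ∀ n : ℕ, HasDerivAt (fun x : ℝ => (x : ℂ) ^ n) (n * (x : ℂ) ^ (n - 1)) x := by
    intro n
    exact (hasDerivAt_pow n (x : ℂ)).comp_ofReal
  have h1 := HasDerivAt.fun_sum (u := Finset.range (k + 1)) (fun i _ =>
    ((hP (k - i)).mul hE).const_mul ((k.choose i : ℂ) * C i 0 b))
  rw [funext fun x => C_eq_sum k x b, C_eq_sum k x b, C_eq_sum (k - 1) x b]
  refine h1.congr_deriv ?_
  rw [Finset.mul_sum, Finset.mul_sum]
  rcases k with _ | k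
  · simp; ring
  · rw [Finset.sum_range_succ _ (k + 1), Finset.sum_range_succ _ (k + 1)]
    simp only [Nat.add_sub_cancel]
    rw [← sub_sub, ← Finset.sum_sub_distrib]
    simp only [Nat.sub_self, pow_zero, Nat.cast_zero]
    rw [sub_eq_add_neg]
    congr 1
    · refine Finset.sum_congr rfl fun i hi => ?_
      have hi' : i ≤ k := Nat.lt_succ_iff.1 (Finset.mem_range.1 hi)
      have h2 : ((k + 1).choose i : ℂ) * ((k + 1 - i : ℕ) : ℂ) = (k + 1 : ℕ) * (k.choose i : ℂ) := by
        have := Nat.choose_mul_succ_eq k i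
        rw [← Nat.cast_mul, ← this]
        push_cast
        ring
      rw [show k + 1 - i - 1 = k - i by omega]
      linear_combination C i 0 b * (x : ℂ) ^ (k - i) *
        Complex.exp (-(2 * Real.pi * Complex.I * b) * x) * h2
    · ring

/-- The standard character `x ↦ e^{2πix}` of `ℝ`. -/
noncomputable def e (x : ℝ) : ℂ := Complex.exp (2 * Real.pi * Complex.I * (x : ℂ))

@[simp] theorem e_zero : e 0 = 1 := by simp [e]

theorem e_add (x y : ℝ) : e (x + y) = e x * e y := by
  rw [e, e, e, ← Complex.exp_add]
  congr 1
  push_cast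
  ring

@[simp] theorem e_intCast (n : ℤ) : e n = 1 := by
  rw [e, Complex.exp_eq_one_iff]
  exact ⟨n, by push_cast; ring⟩

theorem e_eq_one_iff (x : ℝ) : e x = 1 ↔ ∃ n : ℤ, x = n := by
  refine ⟨fun h => ?_, ?_⟩
  · rw [e, Complex.exp_eq_one_iff] at h
    obtain ⟨n, hn⟩ := h
    refine ⟨n, ?_⟩
    have h2 : (2 * Real.pi * Complex.I : ℂ) ≠ 0 := Complex.two_pi_I_ne_zero
    have h3 : (x : ℂ) = (n : ℂ) := mul_left_cancel₀ h2 (hn.trans (mul_comm _ _))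
    exact_mod_cast h3
  · rintro ⟨n, rfl⟩
    simp

@[simp] theorem norm_e (x : ℝ) : ‖e x‖ = 1 := by
  rw [e, show (2 * Real.pi * Complex.I * (x : ℂ)) = ((2 * Real.pi * x : ℝ) : ℂ) * Complex.I by
    push_cast; ring]
  exact Complex.norm_exp_ofReal_mul_I _

theorem e_sum {ι : Type*} (s : Finset ι) (x : ι → ℝ) : e (∑ i ∈ s, x i) = ∏ i ∈ s, e (x i) := by
  simp only [e]
  rw [← Complex.exp_sum, Complex.ofReal_sum, Finset.mul_sum]

@[fun_prop]
theorem continuous_e : Continuous e := by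
  unfold e
  fun_prop

theorem hasDerivAt_e (x : ℝ) : HasDerivAt e (2 * Real.pi * Complex.I * e x) x := by
  have := ((hasDerivAt_id (x : ℂ)).const_mul (2 * Real.pi * Complex.I)).cexp.comp_ofReal
  refine this.congr_deriv ?_
  simp [e, mul_comm]

theorem hasDerivAt_e_mul (c x : ℝ) :
    HasDerivAt (fun x => e (c * x)) (2 * Real.pi * Complex.I * c * e (c * x)) x := by
  have h := HasDerivAt.scomp x (hasDerivAt_e (c * x)) ((hasDerivAt_id x).const_mul c)
  refine h.congr_deriv ?_
  rw [mul_one, Complex.real_smul]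
  ring

theorem norm_e_sub_one_le (x : ℝ) : ‖e x - 1‖ ≤ 2 * Real.pi * |x| := by
  rw [e, show (2 * Real.pi * Complex.I * (x : ℂ)) = Complex.I * ((2 * Real.pi * x : ℝ) : ℂ) by
    push_cast; ring]
  refine (Real.norm_exp_I_mul_ofReal_sub_one_le).trans ?_
  rw [Real.norm_eq_abs, abs_mul, abs_of_pos Real.two_pi_pos]

/-- The factor `-(2πi)^k / k!`. -/
noncomputable def normFactor (k : ℕ) : ℂ :=
  -((2 * Real.pi * Complex.I) ^ k / (k.factorial : ℂ))

/-- The Fourier coefficients of `x ↦ -((2πi)^k / k!) C(k, x; b)` on `[0, 1]`. -/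
noncomputable def coeff (k : ℕ) (b : ℂ) (n : ℤ) : ℂ :=
  if k = 0 then (if (n : ℂ) + b = 0 then -1 else 0) else (((n : ℂ) + b) ^ k)⁻¹

theorem integral_C_recursion (k : ℕ) (b : ℂ) (n : ℤ) :
    k * (∫ x in (0 : ℝ)..1, C (k - 1) x b * e (-(n * x))) -
      2 * Real.pi * Complex.I * (n + b) * (∫ x in (0 : ℝ)..1, C k x b * e (-(n * x))) =
      if k = 1 then 1 else 0 := by
  have hd : ∀ x : ℝ, HasDerivAt (fun x : ℝ => C k x b * e (-(n * x)))
      (k * (C (k - 1) x b * e (-(n * x))) -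
        2 * Real.pi * Complex.I * (n + b) * (C k x b * e (-(n * x)))) x := by
    intro x
    have h1 := (hasDerivAt_C k b x).mul (hasDerivAt_e_mul (-n) x)
    simp only [neg_mul] at h1
    refine h1.congr_deriv ?_
    push_cast
    ring
  have hc : ∀ j : ℕ, Continuous fun x : ℝ => C j x b * e (-(n * x)) := by
    intro j
    exact (continuous_C j b).mul (by fun_prop)
  have h2 := intervalIntegral.integral_eq_sub_of_hasDerivAt (a := 0) (b := 1) (fun x _ => hd x)
    (Continuous.intervalIntegrable (((hc _).const_mul _).sub ((hc _).const_mul _)) _ _)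
  rw [intervalIntegral.integral_sub (((hc _).const_mul _).intervalIntegrable _ _)
    (((hc _).const_mul _).intervalIntegrable _ _), intervalIntegral.integral_const_mul,
    intervalIntegral.integral_const_mul] at h2
  rw [h2, ← C_one_sub_C_zero k b]
  have h3 : e (-(n * 1)) = 1 := by
    rw [mul_one, ← Int.cast_neg]
    exact e_intCast _
  rw [h3]
  simp

theorem normFactor_succ (k : ℕ) :
    normFactor (k + 1) * (k + 1) = normFactor k * (2 * Real.pi * Complex.I) := by
  unfold normFactor
  rw [Nat.factorial_succ]
  have h1 : (k.factorial : ℂ) ≠ 0 := by exact_mod_cast k.factorial_ne_zero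
  have h2 : (k + 1 : ℂ) ≠ 0 := by exact_mod_cast k.succ_ne_zero
  push_cast
  field_simp
  rw [pow_succ]
  ring

theorem normFactor_mul_integral_C (k : ℕ) (b : ℂ) (n : ℤ) :
    normFactor k * (∫ x in (0 : ℝ)..1, C k x b * e (-(n * x))) = coeff k b n := by
  have hpi : (2 * Real.pi * Complex.I : ℂ) ≠ 0 := Complex.two_pi_I_ne_zero
  by_cases hn : (n : ℂ) + b = 0
  · have h1 := integral_C_recursion (k + 1) b n
    rw [hn, mul_zero, zero_mul, sub_zero, Nat.add_sub_cancel] at h1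
    have h2 : ((k + 1 : ℕ) : ℂ) ≠ 0 := by exact_mod_cast k.succ_ne_zero
    rcases k with _ | k
    · simp only [zero_add, Nat.cast_one, one_mul, if_true] at h1
      rw [h1]
      simp [normFactor, coeff, hn]
    · rw [if_neg (by omega)] at h1
      rw [(mul_eq_zero.1 h1).resolve_left h2]
      simp [coeff, hn]
  · have hne : (2 * Real.pi * Complex.I * (n + b) : ℂ) ≠ 0 := mul_ne_zero hpi hn
    have h0 : (∫ x in (0 : ℝ)..1, C 0 x b * e (-(n * x))) = 0 := by
      have := integral_C_recursion 0 b n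
      simpa [hn] using this
    rcases k with _ | k
    · rw [h0]
      simp [coeff, hn]
    · induction k with
      | zero =>
        have h1 := integral_C_recursion 1 b n
        simp only [Nat.sub_self, h0, if_true, mul_zero, zero_sub] at h1
        simp only [zero_add, normFactor, coeff, one_ne_zero, if_false, pow_one,
          Nat.factorial_one, Nat.cast_one, div_one]
        rw [← mul_eq_one_iff_eq_inv₀ hn]
        linear_combination h1
      | succ k ih =>
        have h1 := integral_C_recursion (k + 2) b n
        rw [if_neg (by omega), show k + 2 - 1 = k + 1 by omega] at h1
        have h3 := normFactor_succ (k + 1)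
        simp only [coeff, Nat.add_eq_zero_iff, one_ne_zero, and_false, if_false] at ih ⊢
        rw [← mul_eq_one_iff_eq_inv₀ (pow_ne_zero _ hn)] at ih ⊢
        rw [← ih]
        refine mul_left_cancel₀ hpi ?_
        push_cast at h1 h3
        have h4 : (n + b : ℂ) ^ (k + 1 + 1) = (n + b) ^ (k + 1) * (n + b) := pow_succ _ _
        rw [h4]
        linear_combination (n + b : ℂ) ^ (k + 1) * (-normFactor (k + 1 + 1) * h1 +
          (∫ x in (0 : ℝ)..1, C (k + 1) x b * e (-(n * x))) * h3)

/-- A continuous function on `[0, 1]` with equal values at the end points and summable Fourier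
coefficients is the sum of its Fourier series. -/
theorem hasSum_fourier {g : ℝ → ℂ} (hg : Continuous g) (h01 : g 0 = g 1) {a : ℤ → ℂ}
    (ha : Summable a) (hint : ∀ n : ℤ, ∫ x in (0 : ℝ)..1, g x * e (-(n * x)) = a n) (x : ℝ) :
    HasSum (fun n : ℤ => a n * e (n * x)) (g (Int.fract x)) := by
  let G : C(AddCircle (1 : ℝ), ℂ) :=
    ⟨AddCircle.liftIco 1 0 g, AddCircle.liftIco_continuous (by simpa using h01) hg.continuousOn⟩
  have hfour : ∀ (n : ℤ) (z : ℝ), fourier n (z : AddCircle (1 : ℝ)) = e (n * z) := by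
    intro n z
    rw [fourier_coe_apply, e]
    congr 1
    push_cast
    ring
  have hcoeff : fourierCoeff G = a := by
    funext n
    rw [← hint n]
    change fourierCoeff (AddCircle.liftIco 1 0 g) n = _
    rw [fourierCoeff_liftIco_eq, fourierCoeffOn_eq_integral]
    simp only [zero_add, sub_zero, div_one, one_smul, smul_eq_mul]
    refine intervalIntegral.integral_congr fun z _ => ?_
    change fourier (-n) (z : AddCircle (0 + 1 - 0 : ℝ)) * g z = _
    rw [fourier_coe_apply, mul_comm, e]
    congr 2
    push_cast
    ring
  have h := has_pointwise_sum_fourier_series_of_summable (f := G) (by rwa [hcoeff])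
    ((Int.fract x : ℝ) : AddCircle (1 : ℝ))
  rw [hcoeff] at h
  have h1 : G ((Int.fract x : ℝ) : AddCircle (1 : ℝ)) = g (Int.fract x) :=
    AddCircle.liftIco_coe_apply ⟨Int.fract_nonneg x, by simpa using Int.fract_lt_one x⟩
  rw [h1] at h
  refine h.congr_fun fun n => ?_
  rw [smul_eq_mul, hfour]
  congr 1
  rw [← Int.self_sub_floor x]
  rw [mul_sub, sub_eq_add_neg, e_add, ← Int.cast_mul, ← Int.cast_neg, e_intCast, mul_one]

/-- The weight `1 / (1 + |n|)`. -/
noncomputable def decay (n : ℤ) : ℝ := (1 + |(n : ℝ)|)⁻¹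

theorem decay_pos (n : ℤ) : 0 < decay n := inv_pos.2 (by positivity)

theorem decay_nonneg (n : ℤ) : 0 ≤ decay n := (decay_pos n).le

theorem decay_le_one (n : ℤ) : decay n ≤ 1 := inv_le_one_of_one_le₀ (by simp)

theorem decay_mul (n : ℤ) : (1 + |(n : ℝ)|) * decay n = 1 :=
  mul_inv_cancel₀ (by positivity)

theorem summable_decay_rpow {s : ℝ} (hs : 1 < s) : Summable fun n : ℤ => decay n ^ s := by
  have h := (Real.summable_one_div_int_add_rpow (1 / 2) s).2 hs
  refine h.of_nonneg_of_le (fun n => Real.rpow_nonneg (decay_nonneg n) s) fun n => ?_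
  rw [decay, one_div, ← Real.inv_rpow (abs_nonneg _)]
  have h1 : (0 : ℝ) < |(n : ℝ) + 1 / 2| := by
    rw [abs_pos]
    intro h0
    have h2 : ((2 * n + 1 : ℤ) : ℝ) = 0 := by push_cast; linarith
    have h3 : 2 * n + 1 = 0 := by exact_mod_cast h2
    omega
  refine Real.rpow_le_rpow (by positivity) (inv_anti₀ h1 ?_) (by linarith)
  refine (abs_add_le _ _).trans ?_
  rw [abs_of_pos (by norm_num : (0 : ℝ) < 1 / 2)]
  linarith

theorem summable_decay_sq : Summable fun n : ℤ => decay n ^ 2 := by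
  simpa using summable_decay_rpow (s := 2) (by norm_num)

theorem decay_sub_le (n d : ℤ) : decay (n - d) ≤ (1 + |(d : ℝ)|) * decay n := by
  rw [decay, inv_le_iff_one_le_mul₀ (by positivity)]
  calc (1 : ℝ) = (1 + |(n : ℝ)|) * decay n := (decay_mul n).symm
    _ ≤ ((1 + |(d : ℝ)|) * (1 + |((n - d : ℤ) : ℝ)|)) * decay n := by
        refine mul_le_mul_of_nonneg_right ?_ (decay_nonneg n)
        have h : |(n : ℝ)| ≤ |((n - d : ℤ) : ℝ)| + |(d : ℝ)| := by
          push_cast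
          simpa using abs_add_le ((n : ℝ) - d) d
        nlinarith [abs_nonneg (d : ℝ), abs_nonneg ((n - d : ℤ) : ℝ)]
    _ = _ := by ring

theorem exists_norm_inv_add_le (b : ℂ) :
    ∃ K : ℝ, 1 ≤ K ∧ ∀ n : ℤ, ‖((n : ℂ) + b)⁻¹‖ ≤ K * decay n := by
  obtain ⟨R, hR⟩ := exists_nat_ge (‖b‖ + 1)
  set M : ℝ := 1 + ∑ m ∈ Finset.Icc (-(R : ℤ)) R, ‖((m : ℂ) + b)⁻¹‖ with hM
  have hM1 : 1 ≤ M := by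
    rw [hM]
    have : 0 ≤ ∑ m ∈ Finset.Icc (-(R : ℤ)) R, ‖((m : ℂ) + b)⁻¹‖ :=
      Finset.sum_nonneg fun _ _ => norm_nonneg _
    linarith
  have hle : ∀ n : ℤ, ‖((n : ℂ) + b)⁻¹‖ ≤ M := by
    intro n
    by_cases hn : n ∈ Finset.Icc (-(R : ℤ)) R
    · have := Finset.single_le_sum (f := fun m : ℤ => ‖((m : ℂ) + b)⁻¹‖)
        (fun _ _ => norm_nonneg _) hn
      linarith
    · refine le_trans ?_ hM1
      rw [norm_inv]
      refine inv_le_one_of_one_le₀ ?_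
      have h1 : (R : ℝ) ≤ |(n : ℝ)| := by
        rw [Finset.mem_Icc, ← abs_le, not_le] at hn
        exact_mod_cast hn.le
      have h2 : ‖(n : ℂ)‖ ≤ ‖(n : ℂ) + b‖ + ‖b‖ := by
        simpa using norm_sub_le ((n : ℂ) + b) b
      rw [Complex.norm_intCast] at h2
      linarith
  refine ⟨1 + (1 + ‖b‖) * M, by nlinarith [norm_nonneg b], fun n => ?_⟩
  by_cases h0 : (n : ℂ) + b = 0
  · rw [h0]
    simp only [inv_zero, norm_zero]
    have := norm_nonneg b
    have := decay_nonneg n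
    positivity
  · rw [decay, ← div_eq_mul_inv, le_div_iff₀ (by positivity)]
    have h3 : |(n : ℝ)| ≤ ‖(n : ℂ) + b‖ + ‖b‖ := by
      have h2 : ‖(n : ℂ)‖ ≤ ‖(n : ℂ) + b‖ + ‖b‖ := by
        simpa using norm_sub_le ((n : ℂ) + b) b
      rwa [Complex.norm_intCast] at h2
    have h4 : ‖((n : ℂ) + b)⁻¹‖ * ‖(n : ℂ) + b‖ = 1 := by
      rw [← norm_mul, inv_mul_cancel₀ h0, norm_one]
    nlinarith [hle n, norm_nonneg ((n : ℂ) + b)⁻¹, norm_nonneg b,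
      mul_le_mul_of_nonneg_left h3 (norm_nonneg ((n : ℂ) + b)⁻¹),
      mul_le_mul_of_nonneg_right (hle n) (norm_nonneg b)]

theorem decay_ge_of_eq_neg {b : ℂ} {n : ℤ} (h : (n : ℂ) + b = 0) : 1 = (1 + ‖b‖) * decay n := by
  have h1 : ‖b‖ = |(n : ℝ)| := by
    rw [← Complex.norm_intCast, eq_neg_of_add_eq_zero_left h, norm_neg]
  rw [h1, decay_mul]

theorem norm_coeff_le_sq {k : ℕ} (hk : k ≠ 1) (b : ℂ) :
    ∃ K : ℝ, 0 ≤ K ∧ ∀ n : ℤ, ‖coeff k b n‖ ≤ K * decay n ^ 2 := by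
  rcases k with _ | _ | k
  · refine ⟨(1 + ‖b‖) ^ 2, by positivity, fun n => ?_⟩
    simp only [coeff, if_true]
    split_ifs with h
    · rw [norm_neg, norm_one, ← mul_pow, ← decay_ge_of_eq_neg h, one_pow]
    · rw [norm_zero]; positivity
  · exact absurd rfl hk
  · obtain ⟨K, hK1, hK⟩ := exists_norm_inv_add_le b
    refine ⟨K ^ (k + 1 + 1), by positivity, fun n => ?_⟩
    simp only [coeff, Nat.add_eq_zero_iff, one_ne_zero, and_false, if_false]
    rw [← inv_pow, norm_pow]
    refine (pow_le_pow_left₀ (norm_nonneg _) (hK n) _).trans ?_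
    rw [mul_pow]
    refine mul_le_mul_of_nonneg_left ?_ (by positivity)
    exact pow_le_pow_of_le_one (decay_nonneg n) (decay_le_one n) (by omega)

theorem norm_coeff_le (k : ℕ) (b : ℂ) :
    ∃ K : ℝ, 0 ≤ K ∧ ∀ n : ℤ, ‖coeff k b n‖ ≤ K * decay n := by
  by_cases hk : k = 1
  · obtain ⟨K, hK1, hK⟩ := exists_norm_inv_add_le b
    exact ⟨K, by linarith, fun n => by simpa [coeff, hk] using hK n⟩
  · obtain ⟨K, hK0, hK⟩ := norm_coeff_le_sq hk b
    refine ⟨K, hK0, fun n => (hK n).trans (mul_le_mul_of_nonneg_left ?_ hK0)⟩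
    exact pow_le_of_le_one (decay_nonneg n) (decay_le_one n) two_ne_zero

theorem norm_coeff_one_sub_le (b : ℂ) (d : ℤ) :
    ∃ K : ℝ, 0 ≤ K ∧ ∀ n : ℤ, ‖coeff 1 b n - coeff 1 b (n - d)‖ ≤ K * decay n ^ 2 := by
  obtain ⟨K, hK1, hK⟩ := exists_norm_inv_add_le b
  set D : ℝ := 1 + |(d : ℝ)| with hD
  have hD1 : 1 ≤ D := by simp [hD]
  refine ⟨D * K * ((1 + ‖b‖) * D + K * D), by positivity, fun n => ?_⟩
  have hs := decay_nonneg n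
  simp only [coeff, one_ne_zero, if_false, pow_one]
  have hKd : ‖(((n - d : ℤ) : ℂ) + b)⁻¹‖ ≤ K * (D * decay n) :=
    (hK _).trans (mul_le_mul_of_nonneg_left (decay_sub_le n d) (by linarith))
  by_cases h1 : (n : ℂ) + b = 0
  · rw [h1, inv_zero, zero_sub, norm_neg]
    refine hKd.trans ?_
    have h2 := decay_ge_of_eq_neg h1
    calc K * (D * decay n) = K * (D * decay n) * ((1 + ‖b‖) * decay n) := by rw [← h2, mul_one]
      _ = D * K * ((1 + ‖b‖) * 1 + 0) * decay n ^ 2 := by ring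
      _ ≤ _ := by gcongr; positivity
  by_cases h2 : ((n - d : ℤ) : ℂ) + b = 0
  · rw [h2, inv_zero, sub_zero]
    refine (hK n).trans ?_
    have h3 : 1 ≤ (1 + ‖b‖) * (D * decay n) := by
      refine (decay_ge_of_eq_neg h2).le.trans ?_
      exact mul_le_mul_of_nonneg_left (decay_sub_le n d) (by positivity)
    calc K * decay n ≤ K * decay n * ((1 + ‖b‖) * (D * decay n)) :=
          le_mul_of_one_le_right (by positivity) h3
      _ = 1 * K * ((1 + ‖b‖) * D + 0) * decay n ^ 2 := by ring
      _ ≤ _ := by gcongr; positivity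
  · have h3 : ((n : ℂ) + b)⁻¹ - (((n - d : ℤ) : ℂ) + b)⁻¹ =
        -(d : ℂ) * (((n : ℂ) + b)⁻¹ * (((n - d : ℤ) : ℂ) + b)⁻¹) := by
      rw [inv_sub_inv h1 h2, ← mul_inv, div_eq_mul_inv]
      push_cast
      ring
    rw [h3, norm_mul, norm_mul, norm_neg, Complex.norm_intCast]
    calc |(d : ℝ)| * (‖((n : ℂ) + b)⁻¹‖ * ‖(((n - d : ℤ) : ℂ) + b)⁻¹‖)
        ≤ D * ((K * decay n) * (K * (D * decay n))) := by
          gcongr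
          · simp [hD]
          · exact hK n
      _ = D * K * (0 + K * D) * decay n ^ 2 := by ring
      _ ≤ _ := by gcongr; positivity

/-- A trigonometric polynomial with frequencies in `S`. -/
noncomputable def trigPoly (S : Finset ℤ) (α : ℤ → ℂ) (x : ℝ) : ℂ := ∑ n ∈ S, α n * e (n * x)

@[fun_prop]
theorem continuous_trigPoly (S : Finset ℤ) (α : ℤ → ℂ) : Continuous (trigPoly S α) := by
  unfold trigPoly
  fun_prop

/-- There are uniformly bounded trigonometric polynomials converging to `φ` outside `E`, whose
coefficients are dominated by `D` and converge to `a`. -/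
def FourierApprox (D : ℤ → ℝ) (a : ℤ → ℂ) (φ : ℝ → ℂ) (E : Set ℝ) : Prop :=
  ∃ (α : ℕ → ℤ → ℂ) (S : ℕ → Finset ℤ) (K : ℝ),
    (∀ M, ∀ n ∉ S M, α M n = 0) ∧ (∀ M n, ‖α M n‖ ≤ D n) ∧
    (∀ n, Tendsto (fun M => α M n) atTop (𝓝 (a n))) ∧
    (∀ M x, ‖trigPoly (S M) (α M) x‖ ≤ K) ∧
    ∀ x ∉ E, Tendsto (fun M => trigPoly (S M) (α M) x) atTop (𝓝 (φ x))

/-- Absolutely convergent Fourier series can be truncated to trigonometric polynomials. -/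
theorem fourierApprox_of_hasSum {D : ℤ → ℝ} {a : ℤ → ℂ} {φ : ℝ → ℂ} {E : Set ℝ}
    (β : ℕ → ℤ → ℂ) (ψ : ℕ → ℝ → ℂ) (K : ℝ) (hβ : ∀ M, Summable fun n => ‖β M n‖)
    (hψ : ∀ M x, HasSum (fun n : ℤ => β M n * e (n * x)) (ψ M x))
    (hD : ∀ M n, ‖β M n‖ ≤ D n) (ha : ∀ n, Tendsto (fun M => β M n) atTop (𝓝 (a n)))
    (hK : ∀ M x, ‖ψ M x‖ ≤ K) (hφ : ∀ x ∉ E, Tendsto (fun M => ψ M x) atTop (𝓝 (φ x))) :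
    FourierApprox D a φ E := by
  have hS : ∀ M : ℕ, ∃ S : Finset ℤ, Finset.Icc (-(M : ℤ)) M ⊆ S ∧
      ∀ T : Finset ℤ, Disjoint T S → ∑ n ∈ T, ‖β M n‖ < 1 / ((M : ℝ) + 1) := by
    intro M
    have h0 : (0 : ℝ) < 1 / ((M : ℝ) + 1) := by positivity
    obtain ⟨s, hs⟩ := summable_iff_vanishing_norm.1 (hβ M) _ h0
    refine ⟨s ∪ Finset.Icc (-(M : ℤ)) M, Finset.subset_union_right, fun T hT => ?_⟩
    have := hs T (Finset.disjoint_of_subset_right Finset.subset_union_left hT)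
    exact (le_abs_self _).trans_lt this
  choose S hSs hST using hS
  have hclose : ∀ M x, ‖trigPoly (S M) (fun n => if n ∈ S M then β M n else 0) x - ψ M x‖ ≤
      1 / ((M : ℝ) + 1) := by
    intro M x
    have h1 : trigPoly (S M) (fun n => if n ∈ S M then β M n else 0) x =
        ∑ n ∈ S M, β M n * e (n * x) :=
      Finset.sum_congr rfl fun n hn => by simp only [if_pos hn]
    rw [h1]
    refine le_of_tendsto ((tendsto_const_nhds.sub (hψ M x)).norm) ?_
    filter_upwards [eventually_ge_atTop (S M)] with T hT
    rw [← Finset.sum_sdiff hT, sub_add_cancel_right, norm_neg]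
    refine (norm_sum_le _ _).trans (le_trans (le_of_eq ?_)
      (hST M (T \ S M) Finset.sdiff_disjoint).le)
    exact Finset.sum_congr rfl fun n _ => by rw [norm_mul, norm_e, mul_one]
  refine ⟨fun M n => if n ∈ S M then β M n else 0, S, K + 1, fun M n hn => if_neg hn,
    fun M n => ?_, fun n => ?_, fun M x => ?_, fun x hx => ?_⟩
  · simp only
    split_ifs
    · exact hD M n
    · rw [norm_zero]
      exact (norm_nonneg _).trans (hD M n)
  · refine (ha n).congr' ?_
    filter_upwards [eventually_ge_atTop n.natAbs] with M hM
    rw [if_pos (hSs M (Finset.mem_Icc.2 (by omega)))]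
  · have h1 : 1 / ((M : ℝ) + 1) ≤ 1 := by
      rw [div_le_one (by positivity)]
      simp
    have := norm_sub_norm_le (trigPoly (S M) (fun n => if n ∈ S M then β M n else 0) x) (ψ M x)
    linarith [hclose M x, hK M x]
  · have h1 := squeeze_zero_norm (hclose · x) tendsto_one_div_add_atTop_nhds_zero_nat
    simpa using h1.add (hφ x hx)

/-- The function `-((2πi)^k / k!) C(k, x; b)`. -/
noncomputable def normC (k : ℕ) (b : ℂ) (x : ℝ) : ℂ := normFactor k * C k x b

@[fun_prop]
theorem continuous_normC (k : ℕ) (b : ℂ) : Continuous (normC k b) :=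
  continuous_const.mul (continuous_C k b)

theorem normC_zero_eq_one {k : ℕ} (hk : k ≠ 1) (b : ℂ) : normC k b 0 = normC k b 1 := by
  have := C_one_sub_C_zero k b
  rw [if_neg hk] at this
  rw [normC, normC, sub_eq_zero.1 this]

theorem integral_normC (k : ℕ) (b : ℂ) (n : ℤ) :
    ∫ x in (0 : ℝ)..1, normC k b x * e (-(n * x)) = coeff k b n := by
  rw [← normFactor_mul_integral_C, ← intervalIntegral.integral_const_mul]
  simp only [normC, mul_assoc]

theorem exists_norm_fract_le {g : ℝ → ℂ} (hg : Continuous g) :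
    ∃ K, ∀ x ∈ Set.Icc (0 : ℝ) 1, ‖g x‖ ≤ K :=
  isCompact_Icc.exists_bound_of_continuousOn hg.continuousOn

theorem fract_mem_Icc (x : ℝ) : Int.fract x ∈ Set.Icc (0 : ℝ) 1 :=
  ⟨Int.fract_nonneg x, (Int.fract_lt_one x).le⟩

theorem fourierApprox_of_summable {g : ℝ → ℂ} (hg : Continuous g) (h01 : g 0 = g 1)
    {a : ℤ → ℂ} {D : ℤ → ℝ} (hD : Summable D) (haD : ∀ n, ‖a n‖ ≤ D n)
    (hint : ∀ n : ℤ, ∫ x in (0 : ℝ)..1, g x * e (-(n * x)) = a n) :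
    FourierApprox D a (fun x => g (Int.fract x)) ∅ := by
  have ha : Summable fun n => ‖a n‖ := hD.of_nonneg_of_le (fun _ => norm_nonneg _) haD
  obtain ⟨K, hK⟩ := exists_norm_fract_le hg
  exact fourierApprox_of_hasSum (fun _ => a) (fun _ x => g (Int.fract x)) K (fun _ => ha)
    (fun _ x => hasSum_fourier hg h01 ha.of_norm hint x) (fun _ => haD)
    (fun _ => tendsto_const_nhds) (fun _ x => hK _ (fract_mem_Icc x))
    (fun _ _ => tendsto_const_nhds)

theorem fourierApprox_normC_of_ne_one {k : ℕ} (hk : k ≠ 1) (b : ℂ) :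
    ∃ K : ℝ, FourierApprox (fun n => K * decay n ^ 2) (coeff k b)
      (fun x => normC k b (Int.fract x)) ∅ := by
  obtain ⟨K, -, hK⟩ := norm_coeff_le_sq hk b
  exact ⟨K, fourierApprox_of_summable (continuous_normC k b) (normC_zero_eq_one hk b)
    (summable_decay_sq.mul_left K) hK (integral_normC k b)⟩

theorem fourierApprox_one_sub_mul_normC_one (b : ℂ) (d : ℤ) :
    ∃ K : ℝ, FourierApprox (fun n => K * decay n ^ 2)
      (fun n => coeff 1 b n - coeff 1 b (n - d))
      (fun x => (1 - e (d * x)) * normC 1 b (Int.fract x)) ∅ := by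
  obtain ⟨K, -, hK⟩ := norm_coeff_one_sub_le b d
  refine ⟨K, ?_⟩
  have hg : Continuous fun x : ℝ => (1 - e (d * x)) * normC 1 b x := by fun_prop
  have h := fourierApprox_of_summable hg (by simp) (summable_decay_sq.mul_left K) hK ?_
  · convert h using 4 with x
    conv_lhs => rw [← Int.floor_add_fract x]
    rw [mul_add, e_add, ← Int.cast_mul, e_intCast, one_mul]
  · intro n
    rw [← integral_normC, ← integral_normC, ← intervalIntegral.integral_sub
      (Continuous.intervalIntegrable (by fun_prop) _ _)
      (Continuous.intervalIntegrable (by fun_prop) _ _)]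
    refine intervalIntegral.integral_congr fun x _ => ?_
    have : e (-(((n - d : ℤ) : ℝ) * x)) = e (d * x) * e (-(n * x)) := by
      rw [← e_add]
      congr 1
      push_cast
      ring
    simp only [this]
    ring

theorem hasDerivAt_normC_two (b : ℂ) (x : ℝ) :
    HasDerivAt (normC 2 b)
      (2 * Real.pi * Complex.I * (normC 1 b x - b * normC 2 b x)) x := by
  refine ((hasDerivAt_C 2 b x).const_mul (normFactor 2)).congr_deriv ?_
  have h := normFactor_succ 1
  simp only [normC]
  norm_num at h ⊢
  linear_combination C 1 x b * h

/-- A function on `[0, 1]` with bounded derivative and equal values at the end points extends to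
a Lipschitz periodic function. -/
theorem exists_norm_fract_add_sub_le {g g' : ℝ → ℂ} (hg : ∀ x, HasDerivAt g (g' x) x)
    (hg' : Continuous g') (h01 : g 0 = g 1) :
    ∃ K : ℝ, ∀ x ε : ℝ, 0 ≤ ε → ε ≤ 1 →
      ‖g (Int.fract (x + ε)) - g (Int.fract x)‖ ≤ K * ε := by
  obtain ⟨K, hK⟩ := exists_norm_fract_le hg'
  have hlip : ∀ x ∈ Set.Icc (0 : ℝ) 1, ∀ z ∈ Set.Icc (0 : ℝ) 1, x ≤ z →
      ‖g z - g x‖ ≤ K * (z - x) := by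
    intro x hx z hz hxz
    have := (convex_Icc (0 : ℝ) 1).norm_image_sub_le_of_norm_hasDerivWithin_le
      (fun x _ => (hg x).hasDerivWithinAt) hK hx hz
    rwa [Real.norm_of_nonneg (sub_nonneg.2 hxz)] at this
  refine ⟨K, fun x ε h0 h1 => ?_⟩
  have hx := fract_mem_Icc x
  have hf : Int.fract (x + ε) = Int.fract (Int.fract x + ε) := by
    rw [← Int.fract_add_intCast (Int.fract x + ε) ⌊x⌋]
    congr 1
    linarith [Int.floor_add_fract x]
  rcases lt_or_ge (Int.fract x + ε) 1 with h | h
  · rw [hf, Int.fract_eq_self.2 ⟨by linarith [hx.1], h⟩]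
    have := hlip _ hx (Int.fract x + ε) ⟨by linarith [hx.1], h.le⟩ (by linarith)
    rwa [add_sub_cancel_left] at this
  · have h2 : Int.fract x < 1 := Int.fract_lt_one x
    rcases h1.lt_or_eq with h1 | rfl
    · have hf2 : Int.fract (Int.fract x + ε) = Int.fract x + ε - 1 := by
        rw [← Int.fract_sub_one]
        exact Int.fract_eq_self.2 ⟨by linarith, by linarith⟩
      rw [hf, hf2]
      have hz : Int.fract x + ε - 1 ∈ Set.Icc (0 : ℝ) 1 := ⟨by linarith, by linarith⟩
      have e1 := hlip 0 (by simp) _ hz hz.1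
      have e2 := hlip _ hx 1 (by simp) hx.2
      have e3 : g (Int.fract x + ε - 1) - g (Int.fract x) =
          (g (Int.fract x + ε - 1) - g 0) + (g 1 - g (Int.fract x)) := by rw [h01]; ring
      rw [e3]
      refine (norm_add_le _ _).trans ((add_le_add e1 e2).trans (le_of_eq ?_))
      ring
    · rw [Int.fract_add_one, sub_self, norm_zero, mul_one]
      exact (norm_nonneg _).trans (hK 0 (by simp))

theorem hasDerivAt_comp_fract {g : ℝ → ℂ} {g' : ℂ} {x : ℝ} (hx : ¬ ∃ n : ℤ, x = n)
    (hg : HasDerivAt g g' (Int.fract x)) : HasDerivAt (fun x => g (Int.fract x)) g' x := by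
  have h1 : HasDerivAt (fun z : ℝ => g (z - ⌊x⌋)) g' x := by
    have h2 : HasDerivAt g g' (x - ⌊x⌋) := hg
    exact h2.comp_sub_const x _
  refine h1.congr_of_eventuallyEq ?_
  have h3 : (⌊x⌋ : ℝ) < x := lt_of_le_of_ne (Int.floor_le x) fun h => hx ⟨_, h.symm⟩
  filter_upwards [Ioo_mem_nhds h3 (Int.lt_floor_add_one x)] with z hz
  have : ⌊z⌋ = ⌊x⌋ := Int.floor_eq_iff.2 ⟨hz.1.le, hz.2⟩
  rw [← this]
  rfl

theorem tendsto_div_of_hasDerivAt {g : ℝ → ℂ} {g' : ℂ} {x : ℝ} (hg : HasDerivAt g g' x)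
    {ε : ℕ → ℝ} (hε : Tendsto ε atTop (𝓝 0)) (hε0 : ∀ M, ε M ≠ 0) :
    Tendsto (fun M => (g (x + ε M) - g x) / (ε M : ℂ)) atTop (𝓝 g') := by
  have h := hg.tendsto_slope_zero.comp
    (tendsto_nhdsWithin_iff.2 ⟨hε, Eventually.of_forall hε0⟩)
  refine h.congr fun M => ?_
  rw [Function.comp_apply, Complex.real_smul, Complex.ofReal_inv]
  ring

theorem fourierApprox_normC_one (b : ℂ) :
    ∃ K : ℝ, FourierApprox (fun n => K * decay n) (coeff 1 b)
      (fun x => normC 1 b (Int.fract x)) {x | ∃ n : ℤ, x = n} := by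
  have hpi : (2 * Real.pi * Complex.I : ℂ) ≠ 0 := Complex.two_pi_I_ne_zero
  have hnpi : ‖(2 * Real.pi * Complex.I : ℂ)‖ = 2 * Real.pi := by
    simp [abs_of_pos Real.pi_pos]
  obtain ⟨K, hK1, hK⟩ := exists_norm_inv_add_le b
  obtain ⟨K2, -, hK2⟩ := norm_coeff_le_sq (show (2 : ℕ) ≠ 1 by norm_num) b
  have hsum2 : Summable fun n => ‖coeff 2 b n‖ :=
    (summable_decay_sq.mul_left K2).of_nonneg_of_le (fun _ => norm_nonneg _) hK2
  have h2 := hasSum_fourier (continuous_normC 2 b) (normC_zero_eq_one (by norm_num) b)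
    hsum2.of_norm (integral_normC 2 b)
  obtain ⟨Lip, hLip⟩ := exists_norm_fract_add_sub_le (hasDerivAt_normC_two b) (by fun_prop)
    (normC_zero_eq_one (by norm_num) b)
  obtain ⟨K3, hK3⟩ := exists_norm_fract_le (continuous_normC 2 b)
  set ε : ℕ → ℝ := fun M => 1 / ((M : ℝ) + 1) with hε
  have hε0 : ∀ M, 0 < ε M := fun M => by positivity
  have hε1 : ∀ M, ε M ≤ 1 := fun M => by
    simp only [hε]
    rw [div_le_one (by positivity)]
    simp
  have hεlim : Tendsto ε atTop (𝓝 0) := tendsto_one_div_add_atTop_nhds_zero_nat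
  have hnε : ∀ M, ‖(ε M : ℂ)‖ = ε M := fun M => by
    rw [Complex.norm_real, Real.norm_of_nonneg (hε0 M).le]
  have hcoeff2 : ∀ n : ℤ, coeff 2 b n = ((n : ℂ) + b)⁻¹ * ((n : ℂ) + b)⁻¹ := by
    intro n
    simp only [coeff, OfNat.ofNat_ne_zero, if_false]
    rw [pow_two, mul_inv]
  have hq : ∀ (M : ℕ) (n : ℤ),
      ‖(e (n * ε M) - 1) / (2 * Real.pi * Complex.I * ε M)‖ ≤ |(n : ℝ)| := by
    intro M n
    rw [norm_div, norm_mul, hnpi, hnε, div_le_iff₀ (by have := hε0 M; positivity)]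
    refine (norm_e_sub_one_le _).trans (le_of_eq ?_)
    rw [abs_mul, abs_of_pos (hε0 M)]
    ring
  refine ⟨(1 + ‖b‖) * K ^ 2, fourierApprox_of_hasSum
    (fun M n => ((e (n * ε M) - 1) / (2 * Real.pi * Complex.I * ε M) + b) * coeff 2 b n)
    (fun M x => (normC 2 b (Int.fract (x + ε M)) - normC 2 b (Int.fract x)) /
      (2 * Real.pi * Complex.I * ε M) + b * normC 2 b (Int.fract x))
    (Lip / (2 * Real.pi) + ‖b‖ * K3) ?_ ?_ ?_ ?_ ?_ ?_⟩
  · intro M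
    refine (hsum2.mul_left (2 / (2 * Real.pi * ε M) + ‖b‖)).of_nonneg_of_le
      (fun _ => norm_nonneg _) fun n => ?_
    rw [norm_mul]
    refine mul_le_mul_of_nonneg_right ((norm_add_le _ _).trans (add_le_add_left ?_ _))
      (norm_nonneg _)
    rw [norm_div, norm_mul, hnpi, hnε]
    have : ‖e (n * ε M) - 1‖ ≤ 2 := by
      refine (norm_sub_le _ _).trans ?_
      rw [norm_e, norm_one]
      norm_num
    have := hε0 M
    gcongr
  · intro M x
    have h3 := (((h2 (x + ε M)).sub (h2 x)).div_const (2 * Real.pi * Complex.I * ε M)).add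
      ((h2 x).mul_left b)
    refine h3.congr_fun fun n => ?_
    rw [mul_add, e_add]
    ring
  · intro M n
    rw [norm_mul, hcoeff2, norm_mul]
    have h4 : ‖(e (n * ε M) - 1) / (2 * Real.pi * Complex.I * ε M) + b‖ ≤
        (1 + ‖b‖) * (1 + |(n : ℝ)|) := by
      refine (norm_add_le _ _).trans ?_
      nlinarith [hq M n, norm_nonneg b, abs_nonneg (n : ℝ),
        mul_nonneg (norm_nonneg b) (abs_nonneg (n : ℝ))]
    calc _ ≤ (1 + ‖b‖) * (1 + |(n : ℝ)|) * ((K * decay n) * (K * decay n)) := by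
          have := decay_nonneg n
          gcongr
          · exact hK n
          · exact hK n
      _ = (1 + ‖b‖) * K ^ 2 * decay n * ((1 + |(n : ℝ)|) * decay n) := by ring
      _ = _ := by rw [decay_mul, mul_one]
  · intro n
    have h5 := tendsto_div_of_hasDerivAt (hasDerivAt_e_mul n 0) hεlim (fun M => (hε0 M).ne')
    simp only [mul_zero, zero_add, e_zero, mul_one] at h5
    have h6 := ((h5.div_const (2 * Real.pi * Complex.I)).add_const b).mul_const (coeff 2 b n)
    have h7 : (2 * Real.pi * Complex.I * ((n : ℝ) : ℂ) / (2 * Real.pi * Complex.I) + b) *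
        coeff 2 b n = coeff 1 b n := by
      rw [mul_div_cancel_left₀ _ hpi, hcoeff2]
      simp only [coeff, one_ne_zero, if_false, pow_one, Complex.ofReal_intCast]
      by_cases h0 : (n : ℂ) + b = 0
      · simp [h0]
      · rw [mul_inv_cancel_left₀ h0]
    rw [h7] at h6
    refine h6.congr fun M => ?_
    rw [div_div, mul_comm (ε M : ℂ)]
  · intro M x
    refine (norm_add_le _ _).trans (add_le_add ?_ ?_)
    · rw [norm_div, norm_mul, hnpi, hnε, div_le_div_iff₀ (by have := hε0 M; positivity)
        Real.two_pi_pos]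
      have := hLip x (ε M) (hε0 M).le (hε1 M)
      nlinarith [Real.two_pi_pos]
    · rw [norm_mul]
      exact mul_le_mul_of_nonneg_left (hK3 _ (fract_mem_Icc x)) (norm_nonneg _)
  · intro x hx
    have h8 := tendsto_div_of_hasDerivAt
      (hasDerivAt_comp_fract hx (hasDerivAt_normC_two b (Int.fract x))) hεlim
      (fun M => (hε0 M).ne')
    have h9 := (h8.div_const (2 * Real.pi * Complex.I)).add_const (b * normC 2 b (Int.fract x))
    rw [mul_div_cancel_left₀ _ hpi, sub_add_cancel] at h9
    refine h9.congr fun M => ?_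
    rw [div_div, mul_comm (ε M : ℂ)]

variable {r : ℕ}

@[simp] theorem toV_zero : toV (0 : Fin r → ℤ) = 0 := by ext i; simp [toV]

theorem toV_add (v w : Fin r → ℤ) : toV (v + w) = toV v + toV w := by ext i; simp [toV]

theorem toV_sub (v w : Fin r → ℤ) : toV (v - w) = toV v - toV w := by ext i; simp [toV]

theorem toV_smul (a : ℤ) (v : Fin r → ℤ) : toV (a • v) = (a : ℝ) • toV v := by ext i; simp [toV]

theorem toV_injective : Function.Injective (toV (r := r)) := fun v w h => by
  ext i
  have := congrFun h i
  simpa [toV] using this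

theorem toV_dotProduct_toV (v w : Fin r → ℤ) : toV v ⬝ᵥ toV w = ((v ⬝ᵥ w : ℤ) : ℝ) := by
  simp [toV, dotProduct]

theorem toV_dotProduct_single (v : Fin r → ℝ) (j : Fin r) : v ⬝ᵥ toV (Pi.single j 1) = v j := by
  simp [toV, dotProduct, Pi.single_apply]

namespace IsBasisOf

variable {Λ B : Finset (Functional r)}

theorem eq_sum_vec (h : IsBasisOf Λ B) (z : Fin r → ℝ) :
    z = ∑ g ∈ B, (z ⬝ᵥ dualVec B g) • toV g.1 := by
  have hz : z ∈ realSpan B := by rw [h.span_eq_top]; trivial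
  induction hz using Submodule.span_induction with
  | mem x hx =>
    obtain ⟨f, hf, rfl⟩ := hx
    have hf' : f ∈ B := hf
    simp only
    rw [Finset.sum_congr rfl fun g _ => by rw [dualVec_spec h g hf']]
    simp [hf']
  | zero => simp
  | add x w _ _ hx hw =>
    conv_lhs => rw [hx, hw]
    rw [← Finset.sum_add_distrib]
    exact Finset.sum_congr rfl fun g _ => by rw [add_dotProduct, add_smul]
  | smul a x _ hx =>
    conv_lhs => rw [hx]
    rw [Finset.smul_sum]
    exact Finset.sum_congr rfl fun g _ => by rw [smul_dotProduct, smul_assoc]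

theorem eq_sum_dualVec (h : IsBasisOf Λ B) (z : Fin r → ℝ) :
    z = ∑ g ∈ B, (toV g.1 ⬝ᵥ z) • dualVec B g := by
  have key : ∀ x : Fin r → ℝ, x ⬝ᵥ z = x ⬝ᵥ ∑ g ∈ B, (toV g.1 ⬝ᵥ z) • dualVec B g := by
    intro x
    conv_lhs => rw [h.eq_sum_vec x, sum_dotProduct]
    rw [dotProduct_sum]
    refine Finset.sum_congr rfl fun g _ => ?_
    rw [smul_dotProduct, dotProduct_smul, smul_eq_mul, smul_eq_mul, mul_comm]
  ext j
  simpa using key (Pi.single j 1)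

theorem eq_zero_of_dotProduct (h : IsBasisOf Λ B) {z : Fin r → ℝ}
    (hz : ∀ g ∈ B, toV g.1 ⬝ᵥ z = 0) : z = 0 := by
  rw [h.eq_sum_dualVec z]
  exact Finset.sum_eq_zero fun g hg => by rw [hz g hg, zero_smul]

theorem injective_dotProduct (h : IsBasisOf Λ B) {v w : Fin r → ℤ}
    (hvw : ∀ g ∈ B, g.1 ⬝ᵥ v = g.1 ⬝ᵥ w) : v = w := by
  refine toV_injective (sub_eq_zero.1 (h.eq_zero_of_dotProduct fun g hg => ?_))
  rw [dotProduct_sub, toV_dotProduct_toV, toV_dotProduct_toV, hvw g hg, sub_self]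

theorem card_eq (h : IsBasisOf Λ B) : B.card = r := by
  have hsp : ⊤ ≤ Submodule.span ℝ (Set.range (fun f : B => toV f.1.1)) := by
    rw [← h.span_eq_top, realSpan]
    apply Submodule.span_mono
    rintro _ ⟨a, ha, rfl⟩
    exact ⟨⟨a, ha⟩, rfl⟩
  have := Module.finrank_eq_card_basis (Module.Basis.mk h.linearIndependent hsp)
  simpa using this.symm

theorem mono (h : IsBasisOf Λ B) {X : Finset (Functional r)} (hX : B ⊆ X) : IsBasisOf X B :=
  ⟨hX, h.linearIndependent, h.span_eq_top⟩

theorem latticeRank_eq (h : IsBasisOf Λ B) : latticeRank Λ = r := by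
  refine le_antisymm ?_ ?_
  · have := Submodule.finrank_le (lattice Λ)
    simpa [latticeRank] using this
  · let T : (Fin r → ℤ) →ₗ[ℤ] (Fin r → ℝ) :=
      { toFun := toV
        map_add' := toV_add
        map_smul' := fun a v => by
          rw [toV_smul]
          ext i
          simp }
    have h1 : LinearIndependent ℤ (fun f : B => f.1.1) := by
      refine LinearIndependent.of_comp T ?_
      exact h.linearIndependent.restrict_scalars' ℤ
    have h2 : LinearIndependent ℤ (fun f : B => (⟨f.1.1, Submodule.subset_span
        ⟨f.1, h.subset f.2, rfl⟩⟩ : lattice Λ)) :=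
      LinearIndependent.of_comp (lattice Λ).subtype h1
    have h3 := h2.fintype_card_le_finrank
    rw [Fintype.card_coe, h.card_eq] at h3
    exact h3

end IsBasisOf

theorem exists_isBasisOf_of_realSpan_eq_top {X : Finset (Functional r)} (hX : realSpan X = ⊤) :
    ∃ B, IsBasisOf X B := by
  classical
  obtain ⟨κ, a, ha, hsp, hli⟩ := exists_linearIndependent' ℝ (fun f : X => toV f.1.1)
  have hfin : Finite κ := Finite.of_injective a ha
  have := Fintype.ofFinite κ
  let B : Finset (Functional r) := Finset.univ.image fun i : κ => (a i).1
  have hB : ∀ f ∈ B, ∃ i, (a i).1 = f := by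
    intro f hf
    simpa [B] using hf
  refine ⟨B, ⟨fun f hf => ?_, ?_, ?_⟩⟩
  · obtain ⟨i, rfl⟩ := hB f hf
    exact (a i).2
  · choose i hi using hB
    have h1 : (fun f : B => toV f.1.1) = ((fun f : X => toV f.1.1) ∘ a) ∘
        fun f : B => i f.1 f.2 := by
      funext f
      simp [hi]
    rw [h1]
    refine hli.comp _ fun f g hfg => ?_
    have h2 := congrArg (fun j => (a j).1) hfg
    simp only [hi] at h2
    exact Subtype.ext h2
  · rw [eq_top_iff, ← hX, realSpan, realSpan]
    have h1 : ((fun f : Functional r => toV f.1) '' (X : Set (Functional r))) =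
        Set.range (fun f : X => toV f.1.1) := by
      rw [Set.image_eq_range]
      rfl
    rw [h1, ← hsp]
    refine Submodule.span_mono ?_
    rintro _ ⟨i, rfl⟩
    exact ⟨(a i).1, by simp [B], rfl⟩

theorem toV_mem_realSpan {X : Finset (Functional r)} {v : Fin r → ℤ} (hv : v ∈ lattice X) :
    toV v ∈ realSpan X := by
  induction hv using Submodule.span_induction with
  | mem x hx =>
    obtain ⟨g, hg, rfl⟩ := hx
    exact Submodule.subset_span ⟨g, hg, rfl⟩
  | zero => simp
  | add x z _ _ hx hz => rw [toV_add]; exact add_mem hx hz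
  | smul a x _ hx => rw [toV_smul]; exact Submodule.smul_mem _ _ hx

theorem finite_quotient_of_latticeRank {X : Finset (Functional r)} (hX : latticeRank X = r) :
    Finite ((Fin r → ℤ) ⧸ lattice X) :=
  Submodule.finiteQuotientOfFreeOfRankEq _ (by simpa [latticeRank] using hX)

theorem card_smul_mem_lattice {X : Finset (Functional r)} (v : Fin r → ℤ) :
    (Nat.card ((Fin r → ℤ) ⧸ lattice X) : ℤ) • v ∈ lattice X := by
  rw [← Submodule.Quotient.mk_eq_zero, Submodule.Quotient.mk_smul, natCast_zsmul]
  exact card_nsmul_eq_zero'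

theorem exists_isBasisOf {X : Finset (Functional r)} (hX : latticeRank X = r) :
    ∃ B, IsBasisOf X B := by
  refine exists_isBasisOf_of_realSpan_eq_top ?_
  have := finite_quotient_of_latticeRank hX
  have hD : (Nat.card ((Fin r → ℤ) ⧸ lattice X) : ℝ) ≠ 0 := by
    exact_mod_cast Nat.card_pos.ne'
  rw [eq_top_iff]
  intro z _
  have h1 : z = ∑ j, z j • toV (Pi.single j 1) := by
    ext i
    simp [toV, Pi.single_apply]
  rw [h1]
  refine Submodule.sum_mem _ fun j _ => Submodule.smul_mem _ _ ?_
  have h2 := toV_mem_realSpan (card_smul_mem_lattice (X := X) (Pi.single j 1))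
  rw [toV_smul] at h2
  exact (Submodule.smul_mem_iff _ (by simpa using hD)).1 h2

theorem not_isBasisOf_erase {Λ B : Finset (Functional r)} {f : Functional r}
    (hf : f ∈ indispensable Λ) : ¬ IsBasisOf (Λ.erase f) B := fun h =>
  (Finset.mem_filter.1 hf).2 h.latticeRank_eq

namespace IsBasisOf

variable {Λ B : Finset (Functional r)}

theorem mem_of_indispensable (h : IsBasisOf Λ B) {f : Functional r} (hf : f ∈ indispensable Λ) :
    f ∈ B := by
  by_contra hfB
  exact not_isBasisOf_erase hf (h.mono fun g hg =>
    Finset.mem_erase.2 ⟨fun hgf => hfB (hgf ▸ hg), h.subset hg⟩)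

theorem dotProduct_dualVec_of_indispensable (h : IsBasisOf Λ B) {f g : Functional r}
    (hf : f ∈ indispensable Λ) (hg : g ∈ Λ) (hgf : g ≠ f) : toV g.1 ⬝ᵥ dualVec B f = 0 := by
  by_contra hne
  have hfB := h.mem_of_indispensable hf
  have hmem : ∀ g ∈ Λ, g ≠ f → toV g.1 ∈ realSpan (Λ.erase f) := fun g hg hgf =>
    Submodule.subset_span ⟨g, Finset.mem_coe.2 (Finset.mem_erase.2 ⟨hgf, hg⟩), rfl⟩
  have hsum := h.eq_sum_vec (toV g.1)
  rw [← Finset.add_sum_erase _ _ hfB] at hsum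
  have h1 : (toV g.1 ⬝ᵥ dualVec B f) • toV f.1 ∈ realSpan (Λ.erase f) := by
    rw [← sub_eq_iff_eq_add] at hsum
    rw [← hsum]
    refine sub_mem (hmem g hg hgf) (Submodule.sum_mem _ fun x hx => Submodule.smul_mem _ _ ?_)
    exact hmem x (h.subset (Finset.mem_of_mem_erase hx)) (Finset.ne_of_mem_erase hx)
  have h2 := (Submodule.smul_mem_iff _ hne).1 h1
  have h3 : realSpan (Λ.erase f) = ⊤ := by
    rw [eq_top_iff, ← h.span_eq_top, realSpan, Submodule.span_le]
    rintro _ ⟨x, hx, rfl⟩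
    by_cases hxf : x = f
    · rw [hxf]; exact h2
    · exact hmem x (h.subset hx) hxf
  obtain ⟨B', hB'⟩ := exists_isBasisOf_of_realSpan_eq_top h3
  exact not_isBasisOf_erase hf hB'

theorem exists_dotProduct_dualVec_ne_zero (h : IsBasisOf Λ B) {f : Functional r} (hfB : f ∈ B)
    (hf : f ∉ indispensable Λ) : ∃ g ∈ Λ, g ∉ B ∧ toV g.1 ⬝ᵥ dualVec B f ≠ 0 := by
  by_contra hcon
  push Not at hcon
  have hrank : latticeRank (Λ.erase f) = r := by
    by_contra hne
    exact hf (Finset.mem_filter.2 ⟨h.subset hfB, hne⟩)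
  obtain ⟨B', hB'⟩ := exists_isBasisOf hrank
  have h0 : dualVec B f = 0 := hB'.eq_zero_of_dotProduct fun g hg => by
    have hg' := Finset.mem_erase.1 (hB'.subset hg)
    by_cases hgB : g ∈ B
    · rw [dualVec_spec h f hgB, if_neg hg'.1]
    · exact hcon g hg'.2 hgB
  have := dualVec_spec h f hfB
  simp [h0] at this

theorem finite_quotient (h : IsBasisOf Λ B) : Finite ((Fin r → ℤ) ⧸ lattice B) :=
  finite_quotient_of_latticeRank (h.mono subset_rfl).latticeRank_eq

/-- Some positive multiple of a dual vector is integral. -/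
theorem exists_toV_eq_smul_dualVec (h : IsBasisOf Λ B) (f : Functional r) :
    ∃ (u : Fin r → ℤ) (D : ℕ), 0 < D ∧ toV u = (D : ℝ) • dualVec B f := by
  have := h.finite_quotient
  choose u hu using fun j : Fin r => dualVec_lattice h f (card_smul_mem_lattice (Pi.single j 1))
  refine ⟨u, Nat.card ((Fin r → ℤ) ⧸ lattice B), Nat.card_pos, ?_⟩
  ext j
  have h1 := hu j
  rw [toV_smul, smul_dotProduct, dotProduct_comm, toV_dotProduct_single] at h1
  rw [toV, ← h1]
  simp

/-- The primitive lattice vector dual to an indispensable functional; its character is nontrivial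
at any point off the translates of the hyperplane spanned by the other functionals. -/
theorem exists_primitive_dual (h : IsBasisOf Λ B) {f : Functional r}
    (hf : f ∈ indispensable Λ) {y : Fin r → ℝ} (hy : y ∉ realSpanTranslates (Λ.erase f)) :
    ∃ (u : Fin r → ℤ) (d : ℤ), toV u = (d : ℝ) • dualVec B f ∧
      (∀ g ∈ Λ, g ≠ f → g.1 ⬝ᵥ u = 0) ∧ f.1 ⬝ᵥ u = d ∧ e (y ⬝ᵥ toV u) ≠ 1 := by
  have hfB := h.mem_of_indispensable hf
  obtain ⟨u₀, D, hD, hu₀⟩ := h.exists_toV_eq_smul_dualVec f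
  have hDr : (D : ℝ) ≠ 0 := by exact_mod_cast hD.ne'
  have hfu₀ : f.1 ⬝ᵥ u₀ = D := by
    have := toV_dotProduct_toV f.1 u₀
    rw [hu₀, dotProduct_smul, dualVec_spec h f hfB, if_pos rfl] at this
    simp only [smul_eq_mul, mul_one] at this
    exact_mod_cast this.symm
  have hr : (Finset.univ : Finset (Fin r)).Nonempty := by
    by_contra hne
    rw [Finset.not_nonempty_iff_eq_empty] at hne
    simp only [dotProduct, hne, Finset.sum_empty] at hfu₀
    omega
  obtain ⟨u, hu, hgcd⟩ := Finset.extract_gcd u₀ hr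
  set c := Finset.univ.gcd u₀
  have hu' : u₀ = c • u := by
    ext j
    rw [hu j (Finset.mem_univ j)]
    rfl
  have hc : (c : ℝ) ≠ 0 := by
    intro h0
    have h0' : c = 0 := by exact_mod_cast h0
    rw [hu', h0', zero_smul, dotProduct_zero] at hfu₀
    omega
  have hu1 : toV u = ((f.1 ⬝ᵥ u : ℤ) : ℝ) • dualVec B f := by
    have h1 : toV u = ((c : ℝ)⁻¹ * D) • dualVec B f := by
      rw [mul_smul, ← hu₀, hu', toV_smul, inv_smul_smul₀ hc]
    rw [← toV_dotProduct_toV, h1, dotProduct_smul, dualVec_spec h f hfB]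
    simp
  refine ⟨u, f.1 ⬝ᵥ u, hu1, fun g hg hgf => ?_, rfl, fun h1 => hy ?_⟩
  · have := toV_dotProduct_toV g.1 u
    rw [hu1, dotProduct_smul, h.dotProduct_dualVec_of_indispensable hf hg hgf, smul_zero] at this
    exact_mod_cast this.symm
  · obtain ⟨m, hm⟩ := (e_eq_one_iff _).1 h1
    obtain ⟨w, hw⟩ := Finset.gcd_eq_sum_mul Finset.univ u
    rw [hgcd] at hw
    have hwu : toV w ⬝ᵥ toV u = 1 := by
      rw [toV_dotProduct_toV]
      have : w ⬝ᵥ u = 1 := by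
        rw [hw]
        simp [dotProduct, mul_comm]
      rw [this, Int.cast_one]
    refine ⟨y - toV (m • w), ?_, m • w, by rw [sub_add_cancel]⟩
    set z := y - toV (m • w) with hz
    have hzu : z ⬝ᵥ toV u = 0 := by
      rw [hz, sub_dotProduct, hm, toV_smul, smul_dotProduct, hwu]
      simp
    have hfu : ((f.1 ⬝ᵥ u : ℤ) : ℝ) ≠ 0 := by
      intro h0
      rw [h0, zero_smul] at hu1
      rw [hu1] at hwu
      simp at hwu
    have hzf : z ⬝ᵥ dualVec B f = 0 := by
      rw [hu1, dotProduct_smul] at hzu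
      exact (smul_eq_zero.1 hzu).resolve_left hfu
    rw [h.eq_sum_vec z, ← Finset.add_sum_erase _ _ hfB, hzf, zero_smul, zero_add]
    refine Submodule.sum_mem _ fun x hx => Submodule.smul_mem _ _ ?_
    exact Submodule.subset_span ⟨x, Finset.mem_coe.2 (Finset.mem_erase.2
      ⟨Finset.ne_of_mem_erase hx, h.subset (Finset.mem_of_mem_erase hx)⟩), rfl⟩

end IsBasisOf

theorem sum_prod_le_pow_tsum {ι κ : Type*} (T : Finset κ) (B : Finset ι) (p : κ → ι → ℤ)
    (hp : ∀ v ∈ T, ∀ w ∈ T, (∀ g ∈ B, p v g = p w g) → v = w) {s : ℤ → ℝ} (hs0 : ∀ n, 0 ≤ s n)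
    (hs : Summable s) : ∑ v ∈ T, ∏ g ∈ B, s (p v g) ≤ (∑' n, s n) ^ B.card := by
  classical
  let q : κ → B → ℤ := fun v g => p v g
  calc ∑ v ∈ T, ∏ g ∈ B, s (p v g) = ∑ v ∈ T, ∏ g : B, s (q v g) :=
        Finset.sum_congr rfl fun v _ => (Finset.prod_coe_sort B fun g => s (p v g)).symm
    _ = ∑ x ∈ T.image q, ∏ g : B, s (x g) := by
        rw [Finset.sum_image]
        intro v hv w hw hvw
        exact hp v hv w hw fun g hg => congrFun hvw ⟨g, hg⟩
    _ ≤ ∑ x ∈ Fintype.piFinset fun g : B => T.image fun v => q v g, ∏ g : B, s (x g) := by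
        refine Finset.sum_le_sum_of_subset_of_nonneg ?_ fun _ _ _ =>
          Finset.prod_nonneg fun _ _ => hs0 _
        intro x hx
        obtain ⟨v, hv, rfl⟩ := Finset.mem_image.1 hx
        exact Fintype.mem_piFinset.2 fun g => Finset.mem_image.2 ⟨v, hv, rfl⟩
    _ = ∏ g : B, ∑ n ∈ T.image fun v => q v g, s n := by rw [Finset.prod_univ_sum]
    _ ≤ ∏ _g : B, ∑' n, s n :=
        Finset.prod_le_prod (fun _ _ => Finset.sum_nonneg fun _ _ => hs0 _)
          fun _ _ => hs.sum_le_tsum _ fun _ _ => hs0 _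
    _ = (∑' n, s n) ^ B.card := by simp

theorem IsBasisOf.summable_prod_decay_rpow {Λ B : Finset (Functional r)} (h : IsBasisOf Λ B)
    {s : ℝ} (hs : 1 < s) :
    Summable fun v : Fin r → ℤ => ∏ g ∈ B, decay (g.1 ⬝ᵥ v) ^ s :=
  summable_of_sum_le (fun _ => Finset.prod_nonneg fun _ _ => Real.rpow_nonneg (decay_nonneg _) _)
    fun T => sum_prod_le_pow_tsum T B (fun v g => g.1 ⬝ᵥ v)
      (fun _ _ _ _ hvw => h.injective_dotProduct hvw)
      (fun n => Real.rpow_nonneg (decay_nonneg n) s) (summable_decay_rpow hs)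

/-- Power counting: the product of the decay weights is summable if the indispensable
functionals carry exponent at least `2`. -/
theorem summable_prod_decay (hr : 0 < r) {Λ : Finset (Functional r)} (hΛ : latticeRank Λ = r)
    (p : Functional r → ℕ) (hp : ∀ f ∈ Λ, 1 ≤ p f) (hp2 : ∀ f ∈ indispensable Λ, 2 ≤ p f) :
    Summable fun v : Fin r → ℤ => ∏ f ∈ Λ, decay (f.1 ⬝ᵥ v) ^ p f := by
  classical
  obtain ⟨B₀, hB₀⟩ := exists_isBasisOf hΛ
  have hB : ∀ f : Functional r, ∃ B, IsBasisOf Λ B ∧ (f ∈ Λ → f ∉ B ∨ f ∈ indispensable Λ) := by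
    intro f
    by_cases hf : f ∈ Λ → f ∈ indispensable Λ
    · exact ⟨B₀, hB₀, fun h => Or.inr (hf h)⟩
    · have hf' : latticeRank (Λ.erase f) = r := by
        by_contra hne
        exact hf fun h => Finset.mem_filter.2 ⟨h, hne⟩
      obtain ⟨B, hB⟩ := exists_isBasisOf hf'
      refine ⟨B, hB.mono (hB.subset.trans (Finset.erase_subset _ _)), fun _ => Or.inl fun h => ?_⟩
      exact Finset.ne_of_mem_erase (hB.subset h) rfl
  choose B hB hfB using hB
  have hne : Λ.Nonempty := by
    have h1 : B₀.Nonempty := Finset.card_pos.1 (by rw [hB₀.card_eq]; exact hr)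
    exact h1.mono hB₀.subset
  have hrr : (0 : ℝ) < r := by exact_mod_cast hr
  have hs : (1 : ℝ) < 1 / r + 1 := by
    have : (0 : ℝ) < 1 / r := by positivity
    linarith
  refine Summable.of_nonneg_of_le
    (fun v => Finset.prod_nonneg fun f _ => pow_nonneg (decay_nonneg _) _) (fun v => ?_)
    (summable_sum fun f (_ : f ∈ Λ) => (hB f).summable_prod_decay_rpow hs)
  set x : Functional r → ℝ := fun f => decay (f.1 ⬝ᵥ v)
  have hx0 : ∀ f, 0 < x f := fun f => decay_pos _
  have hx1 : ∀ f, x f ≤ 1 := fun f => decay_le_one _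
  have hpow : ∀ f ∈ Λ, x f ^ p f ≤ x f := fun f hf =>
    pow_le_of_le_one (hx0 f).le (hx1 f) (by have := hp f hf; omega)
  have hsub : ∀ S ⊆ Λ, ∏ f ∈ Λ, x f ^ p f ≤ ∏ f ∈ S, x f ^ p f := fun S hS =>
    Finset.prod_le_prod_of_subset_of_le_one hS (fun f _ => pow_nonneg (hx0 f).le _)
      fun f _ _ => pow_le_one₀ (hx0 f).le (hx1 f)
  have hsub' : ∀ S ⊆ Λ, ∏ f ∈ S, x f ^ p f ≤ ∏ f ∈ S, x f := fun S hS =>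
    Finset.prod_le_prod (fun f _ => pow_nonneg (hx0 f).le _) fun f hf => hpow f (hS hf)
  obtain ⟨f, hf, hmin⟩ := Finset.exists_min_image Λ x hne
  have key : ∏ f ∈ Λ, x f ^ p f ≤ x f * ∏ g ∈ B f, x g := by
    by_cases hfBf : f ∈ B f
    · have hind := (hfB f hf).resolve_left (not_not.2 hfBf)
      refine (hsub _ (hB f).subset).trans ?_
      rw [← Finset.mul_prod_erase _ _ hfBf, ← Finset.mul_prod_erase (B f) x hfBf, ← mul_assoc]
      refine mul_le_mul ?_ (hsub' _ ((Finset.erase_subset _ _).trans (hB f).subset))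
        (Finset.prod_nonneg fun _ _ => pow_nonneg (hx0 _).le _) (mul_self_nonneg _)
      rw [← pow_two]
      exact pow_le_pow_of_le_one (hx0 f).le (hx1 f) (hp2 f hind)
    · have hsubs : insert f (B f) ⊆ Λ := Finset.insert_subset hf (hB f).subset
      refine (hsub _ hsubs).trans ((hsub' _ hsubs).trans (le_of_eq ?_))
      rw [Finset.prod_insert hfBf]
  have h2 : x f ≤ ∏ g ∈ B f, x g ^ (1 / r : ℝ) := by
    calc x f = ∏ _g ∈ B f, x f ^ (1 / r : ℝ) := by
          rw [Finset.prod_const, (hB f).card_eq, ← Real.rpow_natCast, ← Real.rpow_mul (hx0 f).le,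
            one_div_mul_cancel hrr.ne', Real.rpow_one]
      _ ≤ _ := Finset.prod_le_prod (fun _ _ => Real.rpow_nonneg (hx0 f).le _) fun g hg =>
          Real.rpow_le_rpow (hx0 f).le (hmin g ((hB f).subset hg)) (by positivity)
  calc ∏ f ∈ Λ, x f ^ p f ≤ x f * ∏ g ∈ B f, x g := key
    _ ≤ (∏ g ∈ B f, x g ^ (1 / r : ℝ)) * ∏ g ∈ B f, x g :=
        mul_le_mul_of_nonneg_right h2 (Finset.prod_nonneg fun g _ => (hx0 g).le)
    _ = ∏ g ∈ B f, x g ^ (1 / r + 1 : ℝ) := by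
        rw [← Finset.prod_mul_distrib]
        exact Finset.prod_congr rfl fun g _ => by
          rw [Real.rpow_add (hx0 g), Real.rpow_one]
    _ ≤ _ := Finset.single_le_sum (f := fun f => ∏ g ∈ B f, x g ^ (1 / r + 1 : ℝ))
        (fun f _ => Finset.prod_nonneg fun g _ => Real.rpow_nonneg (hx0 g).le _) hf

/-- The lattice points of the cube `[-N, N]^r`. -/
noncomputable def box (r N : ℕ) : Finset (Fin r → ℤ) :=
  Fintype.piFinset fun _ => Finset.Icc (-(N : ℤ)) N

theorem mem_box {N : ℕ} {v : Fin r → ℤ} : v ∈ box r N ↔ ∀ j, |v j| ≤ N := by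
  simp [box, Fintype.mem_piFinset, abs_le]

theorem tendsto_box : Tendsto (box r) atTop atTop := by
  refine tendsto_atTop_finset_of_monotone (fun M N hMN v hv => ?_) fun v => ?_
  · rw [mem_box] at hv ⊢
    exact fun j => (hv j).trans (by exact_mod_cast hMN)
  · refine ⟨∑ j, (v j).natAbs, mem_box.2 fun j => ?_⟩
    have := Finset.single_le_sum (f := fun j => (v j).natAbs) (fun _ _ => Nat.zero_le _)
      (Finset.mem_univ j)
    rw [Int.abs_eq_natAbs]
    exact_mod_cast this

theorem abs_dotProduct_le {N : ℕ} {v : Fin r → ℤ} (hv : v ∈ box r N) (g : Fin r → ℤ) :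
    |((g ⬝ᵥ v : ℤ) : ℝ)| ≤ (∑ j, |(g j : ℝ)|) * N := by
  rw [dotProduct, Int.cast_sum, Finset.sum_mul]
  refine (Finset.abs_sum_le_sum_abs _ _).trans (Finset.sum_le_sum fun j _ => ?_)
  rw [Int.cast_mul, abs_mul]
  refine mul_le_mul_of_nonneg_left ?_ (abs_nonneg _)
  exact_mod_cast mem_box.1 hv j

/-- The points of a cube with prescribed `j`-th coordinate where the functional `f` is large. -/
noncomputable def slice (M : ℕ) (f : Functional r) (j : Fin r) (m : ℤ) (t : ℝ) :
    Finset (Fin r → ℤ) :=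
  (box r M).filter fun v => v j = m ∧ t ≤ |((f.1 ⬝ᵥ v : ℤ) : ℝ)|

theorem IsBasisOf.sum_slice_le {Λ B : Finset (Functional r)} (h : IsBasisOf Λ B) {M : ℕ}
    {f : Functional r} (hf : f ∈ B) {j : Fin r} (hj : dualVec B f j ≠ 0) (m : ℤ) {t X s : ℝ}
    (ht : 0 < t) (hs : 0 < s) (hX1 : 1 ≤ X)
    (hX : ∀ g ∈ B, 1 + (∑ i, |(g.1 i : ℝ)|) * M ≤ X) :
    ∑ v ∈ slice M f j m t, ∏ g ∈ B, decay (g.1 ⬝ᵥ v) ≤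
      t⁻¹ * (X ^ s) ^ r * (1 + ∑' n : ℤ, decay n ^ (1 + s)) ^ r := by
  have hsum := summable_decay_rpow (s := 1 + s) (by linarith)
  have hT0 : 0 ≤ ∑' n : ℤ, decay n ^ (1 + s) :=
    tsum_nonneg fun n => Real.rpow_nonneg (decay_nonneg n) _
  have hXs : 1 ≤ X ^ s := Real.one_le_rpow hX1 hs.le
  have hcard : (B.erase f).card ≤ r :=
    (Finset.card_le_card (Finset.erase_subset _ _)).trans h.card_eq.le
  have hinj : ∀ v ∈ slice M f j m t, ∀ w ∈ slice M f j m t,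
      (∀ g ∈ B.erase f, g.1 ⬝ᵥ v = g.1 ⬝ᵥ w) → v = w := by
    intro v hv w hw hvw
    have hvj := (Finset.mem_filter.1 hv).2.1
    have hwj := (Finset.mem_filter.1 hw).2.1
    have h1 := h.eq_sum_dualVec (toV (v - w))
    rw [← Finset.add_sum_erase _ _ hf, Finset.sum_eq_zero, add_zero] at h1
    · have h2 := congrFun h1 j
      have h3 : toV (v - w) j = 0 := by simp [toV, hvj, hwj]
      rw [h3, Pi.smul_apply, smul_eq_mul] at h2
      have h4 := (mul_eq_zero.1 h2.symm).resolve_right hj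
      rw [h4, zero_smul] at h1
      exact sub_eq_zero.1 (toV_injective (h1.trans toV_zero.symm))
    · intro g hg
      rw [toV_dotProduct_toV, dotProduct_sub, hvw g hg, sub_self, Int.cast_zero, zero_smul]
  have hpt : ∀ v ∈ slice M f j m t, ∏ g ∈ B, decay (g.1 ⬝ᵥ v) ≤
      t⁻¹ * (X ^ s) ^ r * ∏ g ∈ B.erase f, decay (g.1 ⬝ᵥ v) ^ (1 + s) := by
    intro v hv
    obtain ⟨hvb, -, hvt⟩ := Finset.mem_filter.1 hv
    rw [← Finset.mul_prod_erase _ _ hf, mul_assoc]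
    refine mul_le_mul ?_ ?_ (Finset.prod_nonneg fun g _ => decay_nonneg _) (by positivity)
    · exact inv_anti₀ ht (by linarith)
    · calc ∏ g ∈ B.erase f, decay (g.1 ⬝ᵥ v)
          ≤ ∏ g ∈ B.erase f, (X ^ s * decay (g.1 ⬝ᵥ v) ^ (1 + s)) := by
            refine Finset.prod_le_prod (fun g _ => decay_nonneg _) fun g hg => ?_
            have hd := decay_pos (g.1 ⬝ᵥ v)
            rw [Real.rpow_add hd, Real.rpow_one, mul_left_comm,
              ← Real.mul_rpow (by linarith) hd.le]
            refine le_mul_of_one_le_right hd.le (Real.one_le_rpow ?_ hs.le)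
            rw [← decay_mul (g.1 ⬝ᵥ v)]
            refine mul_le_mul_of_nonneg_right ?_ hd.le
            have h5 := abs_dotProduct_le hvb g.1
            linarith [hX g (Finset.mem_of_mem_erase hg)]
        _ = (X ^ s) ^ (B.erase f).card * ∏ g ∈ B.erase f, decay (g.1 ⬝ᵥ v) ^ (1 + s) := by
            rw [Finset.prod_mul_distrib, Finset.prod_const]
        _ ≤ _ := mul_le_mul_of_nonneg_right (pow_le_pow_right₀ hXs hcard)
            (Finset.prod_nonneg fun g _ => Real.rpow_nonneg (decay_nonneg _) _)
  refine (Finset.sum_le_sum hpt).trans ?_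
  rw [← Finset.mul_sum]
  refine mul_le_mul_of_nonneg_left ?_ (by positivity)
  refine (sum_prod_le_pow_tsum (slice M f j m t) (B.erase f) (fun v g => g.1 ⬝ᵥ v) hinj
    (fun n => Real.rpow_nonneg (decay_nonneg n) (1 + s)) hsum).trans ?_
  exact (pow_le_pow_left₀ hT0 (by linarith) _).trans (pow_le_pow_right₀ (by linarith) hcard)

theorem sum_biUnion_le_of_nonneg {ι κ : Type*} [DecidableEq κ] (J : Finset ι) (T : ι → Finset κ)
    {F : κ → ℝ} (hF : ∀ v, 0 ≤ F v) : ∑ v ∈ J.biUnion T, F v ≤ ∑ x ∈ J, ∑ v ∈ T x, F v := by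
  classical
  induction J using Finset.induction_on with
  | empty => simp
  | insert a J ha ih =>
    rw [Finset.biUnion_insert, Finset.sum_insert ha]
    refine le_trans ?_ (add_le_add_right ih _)
    rw [← Finset.sum_union_inter]
    exact le_add_of_nonneg_right (Finset.sum_nonneg fun _ _ => hF _)

/-- The boundary layer of the cube of thickness `c` is covered by slices. -/
theorem IsBasisOf.exists_layer_subset {Λ B : Finset (Functional r)} (h : IsBasisOf Λ B) (c : ℕ) :
    ∃ δ : ℝ, 0 < δ ∧ ∀ N : ℕ, 2 * c + 1 ≤ N → box r (N + c) \ box r (N - c) ⊆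
      (((B ×ˢ Finset.univ).filter fun x : Functional r × Fin r => dualVec B x.1 x.2 ≠ 0) ×ˢ
        (Finset.Icc (-(c : ℤ)) c ×ˢ ({1, -1} : Finset ℤ))).biUnion fun x =>
          slice (N + c) x.1.1 x.1.2 (x.2.1 + x.2.2 * N) (δ * N) := by
  set W : ℝ := ∑ g ∈ B, ∑ j, |dualVec B g j| with hW
  have hW0 : 0 ≤ W := Finset.sum_nonneg fun _ _ => Finset.sum_nonneg fun _ _ => abs_nonneg _
  refine ⟨1 / (2 * (1 + W)), by positivity, fun N hN v hv => ?_⟩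
  obtain ⟨hv1, hv2⟩ := Finset.mem_sdiff.1 hv
  rw [mem_box, not_forall] at hv2
  obtain ⟨j, hj⟩ := hv2
  have hjN := mem_box.1 hv1 j
  rw [not_le] at hj
  push_cast [Nat.cast_sub (show c ≤ N by omega)] at hj hjN
  have hNpos : (0 : ℝ) < N := by exact_mod_cast (show 0 < N by omega)
  have hf : ∃ f ∈ B, dualVec B f j ≠ 0 ∧
      1 / (2 * (1 + W)) * N ≤ |((f.1 ⬝ᵥ v : ℤ) : ℝ)| := by
    by_contra hcon
    push Not at hcon
    have h1 : (v j : ℝ) = ∑ g ∈ B, ((g.1 ⬝ᵥ v : ℤ) : ℝ) * dualVec B g j := by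
      have h2 := congrFun (h.eq_sum_dualVec (toV v)) j
      simp only [Finset.sum_apply, Pi.smul_apply, smul_eq_mul, toV_dotProduct_toV] at h2
      exact h2
    have h3 : |(v j : ℝ)| ≤ 1 / (2 * (1 + W)) * N * W := by
      rw [h1]
      refine (Finset.abs_sum_le_sum_abs _ _).trans ?_
      rw [hW, Finset.mul_sum]
      refine Finset.sum_le_sum fun g hg => ?_
      rw [abs_mul]
      by_cases h0 : dualVec B g j = 0
      · rw [h0, abs_zero, mul_zero]
        positivity
      · refine mul_le_mul (hcon g hg h0).le ?_ (abs_nonneg _) (by positivity)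
        exact Finset.single_le_sum (f := fun j => |dualVec B g j|) (fun _ _ => abs_nonneg _)
          (Finset.mem_univ j)
    have h4 : 1 / (2 * (1 + W)) * N * W ≤ N / 2 := by
      rw [one_div_mul_eq_div, div_mul_eq_mul_div, div_le_div_iff₀ (by positivity) two_pos]
      nlinarith
    have h5 : (N : ℝ) < 2 * |(v j : ℝ)| := by
      have : (N : ℤ) < 2 * |v j| := by omega
      exact_mod_cast this
    linarith
  obtain ⟨f, hfB, hfj, hft⟩ := hf
  obtain ⟨i, s, hi, hs, his⟩ : ∃ i s : ℤ, i ∈ Finset.Icc (-(c : ℤ)) c ∧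
      s ∈ ({1, -1} : Finset ℤ) ∧ v j = i + s * N := by
    rcases abs_cases (v j) with ⟨h6, h7⟩ | ⟨h6, h7⟩
    · exact ⟨v j - N, 1, Finset.mem_Icc.2 (by omega), by simp, by ring⟩
    · exact ⟨v j + N, -1, Finset.mem_Icc.2 (by omega), by simp, by ring⟩
  refine Finset.mem_biUnion.2 ⟨((f, j), (i, s)), ?_, Finset.mem_filter.2 ⟨hv1, his, hft⟩⟩
  simp only [Finset.mem_product, Finset.mem_filter, Finset.mem_univ, and_true]
  exact ⟨⟨hfB, hfj⟩, hi, hs⟩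

theorem IsBasisOf.tendsto_sum_layer {Λ B : Finset (Functional r)} (h : IsBasisOf Λ B)
    (c : ℕ) : Tendsto (fun N : ℕ => ∑ v ∈ box r (N + c) \ box r (N - c),
      ∏ g ∈ B, decay (g.1 ⬝ᵥ v)) atTop (𝓝 0) := by
  obtain ⟨δ, hδ, hsub⟩ := h.exists_layer_subset c
  set J := (((B ×ˢ Finset.univ).filter fun x : Functional r × Fin r =>
    dualVec B x.1 x.2 ≠ 0) ×ˢ (Finset.Icc (-(c : ℤ)) c ×ˢ ({1, -1} : Finset ℤ))) with hJ
  set G : ℝ := 1 + 2 * ∑ g ∈ B, ∑ i, |(g.1 i : ℝ)| with hG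
  have hsum0 : 0 ≤ ∑ g ∈ B, ∑ i, |(g.1 i : ℝ)| :=
    Finset.sum_nonneg fun _ _ => Finset.sum_nonneg fun _ _ => abs_nonneg _
  have hG1 : 1 ≤ G := by linarith
  set s : ℝ := 1 / (2 * (r + 1)) with hs
  have hs0 : 0 < s := by positivity
  have hsr : s * r ≤ 1 / 2 := by
    rw [hs, one_div_mul_eq_div, div_le_div_iff₀ (by positivity) two_pos]
    linarith
  set T : ℝ := (1 + ∑' n : ℤ, decay n ^ (1 + s)) ^ r with hT
  have hT0 : 0 ≤ T := by
    have : 0 ≤ ∑' n : ℤ, decay n ^ (1 + s) :=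
      tsum_nonneg fun n => Real.rpow_nonneg (decay_nonneg n) _
    positivity
  have hbound : ∀ N : ℕ, 2 * c + 1 ≤ N → ∑ v ∈ box r (N + c) \ box r (N - c),
      ∏ g ∈ B, decay (g.1 ⬝ᵥ v) ≤
      J.card * (δ⁻¹ * G ^ (1 / 2 : ℝ) * T) * (N : ℝ) ^ (-(1 / 2) : ℝ) := by
    intro N hN
    have hN1 : (1 : ℝ) ≤ N := by exact_mod_cast (show 1 ≤ N by omega)
    have hX1 : 1 ≤ G * N := by nlinarith
    refine (Finset.sum_le_sum_of_subset_of_nonneg (hsub N hN) fun v _ _ =>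
      Finset.prod_nonneg fun g _ => decay_nonneg _).trans ?_
    refine (sum_biUnion_le_of_nonneg _ _ fun v =>
      Finset.prod_nonneg fun g _ => decay_nonneg _).trans ?_
    rw [mul_assoc, ← nsmul_eq_mul]
    refine Finset.sum_le_card_nsmul _ _ _ fun x hx => ?_
    simp only [hJ, Finset.mem_product, Finset.mem_filter] at hx
    refine (h.sum_slice_le hx.1.1.1 hx.1.2 _ (mul_pos hδ (by linarith)) hs0 hX1 ?_).trans ?_
    · intro g hg
      have h1 : ∑ i, |(g.1 i : ℝ)| ≤ ∑ g ∈ B, ∑ i, |(g.1 i : ℝ)| :=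
        Finset.single_le_sum (f := fun g : Functional r => ∑ i, |(g.1 i : ℝ)|)
          (fun _ _ => Finset.sum_nonneg fun _ _ => abs_nonneg _) hg
      have h2 : ((N + c : ℕ) : ℝ) ≤ 2 * N := by
        exact_mod_cast (show N + c ≤ 2 * N by omega)
      have h3 : (∑ i, |(g.1 i : ℝ)|) * ((N + c : ℕ) : ℝ) ≤
          (∑ g ∈ B, ∑ i, |(g.1 i : ℝ)|) * (2 * N) :=
        mul_le_mul h1 h2 (Nat.cast_nonneg _) hsum0
      rw [hG]
      nlinarith
    · rw [← hT]
      have h4 : ((G * N) ^ s) ^ r ≤ G ^ (1 / 2 : ℝ) * (N : ℝ) ^ (1 / 2 : ℝ) := by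
        rw [← Real.mul_rpow (by linarith) (by linarith), ← Real.rpow_natCast,
          ← Real.rpow_mul (by linarith)]
        exact Real.rpow_le_rpow_of_exponent_le hX1 hsr
      have h5 : (N : ℝ)⁻¹ * (N : ℝ) ^ (1 / 2 : ℝ) = (N : ℝ) ^ (-(1 / 2) : ℝ) := by
        rw [← Real.rpow_neg_one, ← Real.rpow_add (by linarith)]
        norm_num
      calc (δ * N)⁻¹ * ((G * N) ^ s) ^ r * T
          ≤ (δ * N)⁻¹ * (G ^ (1 / 2 : ℝ) * (N : ℝ) ^ (1 / 2 : ℝ)) * T := by gcongr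
        _ = δ⁻¹ * G ^ (1 / 2 : ℝ) * T * ((N : ℝ)⁻¹ * (N : ℝ) ^ (1 / 2 : ℝ)) := by
          rw [mul_inv]; ring
        _ = _ := by rw [h5]
  have hlim : Tendsto (fun N : ℕ => J.card * (δ⁻¹ * G ^ (1 / 2 : ℝ) * T) *
      (N : ℝ) ^ (-(1 / 2) : ℝ)) atTop (𝓝 0) := by
    have := (tendsto_rpow_neg_atTop (show (0 : ℝ) < 1 / 2 by norm_num)).comp
      tendsto_natCast_atTop_atTop
    simpa using this.const_mul (J.card * (δ⁻¹ * G ^ (1 / 2 : ℝ) * T))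
  refine tendsto_of_tendsto_of_tendsto_of_le_of_le' tendsto_const_nhds hlim
    (Eventually.of_forall fun N => Finset.sum_nonneg fun v _ =>
      Finset.prod_nonneg fun g _ => decay_nonneg _) ?_
  filter_upwards [eventually_ge_atTop (2 * c + 1)] with N hN using hbound N hN

/-- The sum of `e^{2πi⟨y, v⟩} A(v)` over the cube `[-N, N]^r`. -/
noncomputable def cubeSum (A : (Fin r → ℤ) → ℂ) (y : Fin r → ℝ) (N : ℕ) : ℂ :=
  ∑ v ∈ box r N, e (y ⬝ᵥ toV v) * A v

theorem Z_eq_cubeSum (Λ : Finset (Functional r)) (k : Functional r → ℕ) (y : Fin r → ℝ) (N : ℕ) :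
    Z Λ k y N = cubeSum (fun v => ∏ f ∈ Λ, coeff (k f) f.2 (f.1 ⬝ᵥ v)) y N := by
  rw [Z, cubeSum, Finset.sum_filter, Finset.mul_sum]
  refine Finset.sum_congr rfl fun v _ => ?_
  split_ifs with hv
  · have h0 : Λ.filter (fun f => ¬ 0 < k f) = Λ.filter fun f => k f = 0 :=
      Finset.filter_congr fun f _ => by omega
    rw [← Finset.prod_filter_mul_prod_filter_not Λ fun f => 0 < k f, h0]
    have h1 : ∏ f ∈ Λ.filter (fun f => 0 < k f), coeff (k f) f.2 (f.1 ⬝ᵥ v) =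
        ∏ f ∈ Λ.filter (fun f => 0 < k f), 1 / value f v ^ k f := by
      refine Finset.prod_congr rfl fun f hf => ?_
      rw [coeff, if_neg (by have := (Finset.mem_filter.1 hf).2; omega), one_div]
      rfl
    have h2 : ∏ f ∈ Λ.filter (fun f => k f = 0), coeff (k f) f.2 (f.1 ⬝ᵥ v) =
        (-1) ^ (Λ.filter fun f => k f = 0).card := by
      rw [← Finset.prod_const]
      refine Finset.prod_congr rfl fun f hf => ?_
      obtain ⟨hfΛ, hf0⟩ := Finset.mem_filter.1 hf
      exact (if_pos hf0).trans (if_pos (hv.2 f hfΛ hf0))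
    rw [h1, h2, e]
    ring
  · have h0 : ∏ f ∈ Λ, coeff (k f) f.2 (f.1 ⬝ᵥ v) = 0 := by
      rw [not_and_or] at hv
      rcases hv with hv | hv
      · push Not at hv
        obtain ⟨f, hf, hk, hval⟩ := hv
        refine Finset.prod_eq_zero hf ?_
        have hval' : ((f.1 ⬝ᵥ v : ℤ) : ℂ) + f.2 = 0 := hval
        rw [coeff, if_neg hk.ne', hval', zero_pow hk.ne', inv_zero]
      · push Not at hv
        obtain ⟨f, hf, hk, hval⟩ := hv
        refine Finset.prod_eq_zero hf ?_
        exact (if_pos hk).trans (if_neg hval)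
    rw [h0, mul_zero, mul_zero]

theorem tendsto_cubeSum_of_summable {A : (Fin r → ℤ) → ℂ} (hA : Summable fun v => ‖A v‖)
    (y : Fin r → ℝ) :
    Tendsto (cubeSum A y) atTop (𝓝 (∑' v, e (y ⬝ᵥ toV v) * A v)) := by
  have h : Summable fun v => e (y ⬝ᵥ toV v) * A v := by
    refine Summable.of_norm (hA.congr fun v => ?_)
    rw [norm_mul, norm_e, one_mul]
  exact h.hasSum.comp tendsto_box

/-- Summation by parts: up to a boundary term, multiplication by `1 - e^{2πi⟨y, u⟩}` replaces
the summand by its difference in the direction `u`. -/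
theorem IsBasisOf.tendsto_cubeSum_sub {Λ B : Finset (Functional r)} (h : IsBasisOf Λ B)
    {A : (Fin r → ℤ) → ℂ} {K : ℝ} (hK : 0 ≤ K)
    (hA : ∀ v, ‖A v‖ ≤ K * ∏ g ∈ B, decay (g.1 ⬝ᵥ v)) (y : Fin r → ℝ) (u : Fin r → ℤ) :
    Tendsto (fun N => (1 - e (y ⬝ᵥ toV u)) * cubeSum A y N -
      cubeSum (fun v => A v - A (v - u)) y N) atTop (𝓝 0) := by
  set c : ℕ := ∑ j, (u j).natAbs with hc
  have hcu : ∀ j, |u j| ≤ c := by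
    intro j
    rw [Int.abs_eq_natAbs, hc]
    exact_mod_cast Finset.single_le_sum (f := fun j => (u j).natAbs) (fun _ _ => Nat.zero_le _)
      (Finset.mem_univ j)
  set F : (Fin r → ℤ) → ℂ := fun w => e (y ⬝ᵥ toV w) * A (w - u) with hF
  set K' : ℝ := K * ∏ g ∈ B, (1 + |((g.1 ⬝ᵥ u : ℤ) : ℝ)|) with hK'
  have hFb : ∀ w, ‖F w‖ ≤ K' * ∏ g ∈ B, decay (g.1 ⬝ᵥ w) := by
    intro w
    rw [hF, norm_mul, norm_e, one_mul, hK', mul_assoc, ← Finset.prod_mul_distrib]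
    refine (hA _).trans (mul_le_mul_of_nonneg_left ?_ hK)
    refine Finset.prod_le_prod (fun _ _ => decay_nonneg _) fun g _ => ?_
    rw [dotProduct_sub]
    exact decay_sub_le _ _
  have hlim := (h.tendsto_sum_layer c).const_mul (2 * K')
  rw [mul_zero] at hlim
  refine squeeze_zero_norm' ?_ hlim
  filter_upwards [eventually_ge_atTop c] with N hcN
  set s := box r N
  set t := (box r N).image fun v => v + u with ht
  have hshift : e (y ⬝ᵥ toV u) * cubeSum A y N = ∑ w ∈ t, F w := by
    rw [ht, Finset.sum_image fun a _ b _ hab => add_right_cancel hab, cubeSum, Finset.mul_sum]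
    refine Finset.sum_congr rfl fun v _ => ?_
    rw [hF]
    simp only [add_sub_cancel_right]
    rw [toV_add, dotProduct_add, e_add]
    ring
  have hdiff : (1 - e (y ⬝ᵥ toV u)) * cubeSum A y N -
      cubeSum (fun v => A v - A (v - u)) y N = ∑ w ∈ s \ t, F w - ∑ w ∈ t \ s, F w := by
    rw [Finset.sum_sdiff_sub_sum_sdiff, ← hshift]
    simp only [cubeSum, mul_sub, Finset.sum_sub_distrib, hF, s]
    ring
  have htb : ∀ w, w ∈ t ↔ w - u ∈ box r N := by
    intro w
    rw [ht, Finset.mem_image]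
    exact ⟨fun ⟨v, hv, hvw⟩ => by rw [← hvw, add_sub_cancel_right]; exact hv,
      fun hw => ⟨w - u, hw, sub_add_cancel _ _⟩⟩
  have hst : s \ t ⊆ box r (N + c) \ box r (N - c) := by
    intro w hw
    obtain ⟨h1, h2⟩ := Finset.mem_sdiff.1 hw
    rw [htb] at h2
    rw [Finset.mem_sdiff, mem_box, mem_box]
    rw [mem_box] at h1 h2
    refine ⟨fun j => (h1 j).trans (by push_cast; omega), fun h3 => h2 fun j => ?_⟩
    have h4 := h3 j
    have h5 := abs_sub (w j) (u j)
    have h6 := hcu j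
    push_cast [Nat.cast_sub hcN] at h4
    rw [Pi.sub_apply]
    omega
  have hts : t \ s ⊆ box r (N + c) \ box r (N - c) := by
    intro w hw
    obtain ⟨h1, h2⟩ := Finset.mem_sdiff.1 hw
    rw [htb] at h1
    rw [Finset.mem_sdiff, mem_box, mem_box]
    rw [mem_box] at h1 h2
    refine ⟨fun j => ?_, fun h3 => h2 fun j => (h3 j).trans (by
      push_cast [Nat.cast_sub hcN]; omega)⟩
    have h4 := h1 j
    have h5 := abs_add_le (w j - u j) (u j)
    have h6 := hcu j
    rw [Pi.sub_apply] at h4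
    rw [sub_add_cancel] at h5
    push_cast
    omega
  have hle : ∀ T ⊆ box r (N + c) \ box r (N - c), ‖∑ w ∈ T, F w‖ ≤
      K' * ∑ v ∈ box r (N + c) \ box r (N - c), ∏ g ∈ B, decay (g.1 ⬝ᵥ v) := by
    intro T hT
    rw [Finset.mul_sum]
    refine (norm_sum_le _ _).trans ((Finset.sum_le_sum fun w _ => hFb w).trans ?_)
    exact Finset.sum_le_sum_of_subset_of_nonneg hT fun w _ _ =>
      (norm_nonneg _).trans (hFb w)
  rw [hdiff]
  refine (norm_sub_le _ _).trans ((add_le_add (hle _ hst) (hle _ hts)).trans (le_of_eq ?_))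
  ring

section Differences

variable {Λ B I : Finset (Functional r)} (a : Functional r → ℤ → ℂ) (d : Functional r → ℤ)

open Classical in
/-- The coefficients `a`, with those of the functionals in `J` replaced by differences. -/
noncomputable def diffCoeff (J : Finset (Functional r)) (f : Functional r) (n : ℤ) : ℂ :=
  if f ∈ J then a f n - a f (n - d f) else a f n

theorem exists_norm_prod_diffCoeff_le (hB : B ⊆ Λ) (J : Finset (Functional r))
    (ha : ∀ f, ∃ K : ℝ, 0 ≤ K ∧ ∀ n, ‖a f n‖ ≤ K * decay n) :
    ∃ K : ℝ, 0 ≤ K ∧ ∀ v : Fin r → ℤ, ‖∏ f ∈ Λ, diffCoeff a d J f (f.1 ⬝ᵥ v)‖ ≤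
      K * ∏ g ∈ B, decay (g.1 ⬝ᵥ v) := by
  choose K hK0 hK using ha
  have h1 : ∀ f n, ‖diffCoeff a d J f n‖ ≤ (K f + K f * (1 + |(d f : ℝ)|)) * decay n := by
    intro f n
    have h2 : 0 ≤ K f * (1 + |(d f : ℝ)|) * decay n := by
      have := hK0 f
      have := decay_nonneg n
      positivity
    rw [diffCoeff, add_mul]
    split_ifs
    · refine (norm_sub_le _ _).trans (add_le_add (hK f n) ((hK f _).trans ?_))
      rw [mul_assoc]
      exact mul_le_mul_of_nonneg_left (decay_sub_le n (d f)) (hK0 f)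
    · linarith [hK f n]
  have h3 : ∀ f, 0 ≤ K f + K f * (1 + |(d f : ℝ)|) := fun f => by
    have := hK0 f
    positivity
  refine ⟨∏ f ∈ Λ, (K f + K f * (1 + |(d f : ℝ)|)), Finset.prod_nonneg fun f _ => h3 f,
    fun v => ?_⟩
  rw [norm_prod]
  refine (Finset.prod_le_prod (fun _ _ => norm_nonneg _) fun f _ => h1 f _).trans ?_
  rw [Finset.prod_mul_distrib]
  exact mul_le_mul_of_nonneg_left (Finset.prod_le_prod_of_subset_of_le_one hB
    (fun _ _ => decay_nonneg _) fun _ _ _ => decay_le_one _) (Finset.prod_nonneg fun f _ => h3 f)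

theorem prod_diffCoeff_insert {J : Finset (Functional r)} {f : Functional r} (hf : f ∈ Λ)
    (hfJ : f ∉ J) {u : Fin r → ℤ} (hu : ∀ g ∈ Λ, g ≠ f → g.1 ⬝ᵥ u = 0) (hfu : f.1 ⬝ᵥ u = d f)
    (v : Fin r → ℤ) :
    ∏ g ∈ Λ, diffCoeff a d (insert f J) g (g.1 ⬝ᵥ v) =
      ∏ g ∈ Λ, diffCoeff a d J g (g.1 ⬝ᵥ v) - ∏ g ∈ Λ, diffCoeff a d J g (g.1 ⬝ᵥ (v - u)) := by
  rw [← Finset.mul_prod_erase _ _ hf, ← Finset.mul_prod_erase _ _ hf,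
    ← Finset.mul_prod_erase Λ (fun g => diffCoeff a d J g (g.1 ⬝ᵥ (v - u))) hf]
  have h1 : ∏ g ∈ Λ.erase f, diffCoeff a d (insert f J) g (g.1 ⬝ᵥ v) =
      ∏ g ∈ Λ.erase f, diffCoeff a d J g (g.1 ⬝ᵥ v) := by
    refine Finset.prod_congr rfl fun g hg => ?_
    simp [diffCoeff, Finset.mem_insert, Finset.ne_of_mem_erase hg]
  have h2 : ∏ g ∈ Λ.erase f, diffCoeff a d J g (g.1 ⬝ᵥ (v - u)) =
      ∏ g ∈ Λ.erase f, diffCoeff a d J g (g.1 ⬝ᵥ v) := by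
    refine Finset.prod_congr rfl fun g hg => ?_
    rw [dotProduct_sub, hu g (Finset.mem_of_mem_erase hg) (Finset.ne_of_mem_erase hg), sub_zero]
  rw [h1, h2, ← sub_mul, dotProduct_sub, hfu]
  simp [diffCoeff, hfJ]

theorem IsBasisOf.tendsto_prod_mul_cubeSum_sub (h : IsBasisOf Λ B) (hI : I ⊆ Λ)
    (ha : ∀ f, ∃ K : ℝ, 0 ≤ K ∧ ∀ n, ‖a f n‖ ≤ K * decay n) (u : Functional r → Fin r → ℤ)
    (hu : ∀ f ∈ I, ∀ g ∈ Λ, g ≠ f → g.1 ⬝ᵥ u f = 0) (hfu : ∀ f ∈ I, f.1 ⬝ᵥ u f = d f)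
    (y : Fin r → ℝ) :
    Tendsto (fun N => (∏ f ∈ I, (1 - e (y ⬝ᵥ toV (u f)))) *
        cubeSum (fun v => ∏ f ∈ Λ, a f (f.1 ⬝ᵥ v)) y N -
      cubeSum (fun v => ∏ f ∈ Λ, diffCoeff a d I f (f.1 ⬝ᵥ v)) y N) atTop (𝓝 0) := by
  classical
  induction I using Finset.induction_on with
  | empty => simp [diffCoeff]
  | insert f J hfJ ih =>
    have h1 := ih (fun g hg => hI (Finset.mem_insert_of_mem hg))
      (fun g hg => hu g (Finset.mem_insert_of_mem hg))
      (fun g hg => hfu g (Finset.mem_insert_of_mem hg))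
    obtain ⟨K, hK0, hK⟩ := exists_norm_prod_diffCoeff_le a d h.subset J ha
    have h2 := h.tendsto_cubeSum_sub hK0 hK y (u f)
    have h3 := (h1.const_mul (1 - e (y ⬝ᵥ toV (u f)))).add h2
    rw [mul_zero, add_zero] at h3
    refine h3.congr fun N => ?_
    have h4 : (fun v => ∏ g ∈ Λ, diffCoeff a d (insert f J) g (g.1 ⬝ᵥ v)) = fun v =>
        ∏ g ∈ Λ, diffCoeff a d J g (g.1 ⬝ᵥ v) -
          ∏ g ∈ Λ, diffCoeff a d J g (g.1 ⬝ᵥ (v - u f)) :=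
      funext fun v => prod_diffCoeff_insert a d (hI (Finset.mem_insert_self _ _)) hfJ
        (hu f (Finset.mem_insert_self _ _)) (hfu f (Finset.mem_insert_self _ _)) v
    rw [h4, Finset.prod_insert hfJ]
    ring

end Differences

theorem mk_out {X : Finset (Functional r)} (w : (Fin r → ℤ) ⧸ lattice X) :
    Submodule.Quotient.mk (p := lattice X) (Quotient.out w) = w :=
  Quotient.out_eq' w

/-- Orthogonality of the characters of `ℤ^r / ⟨vec X⟩`. -/
theorem sum_e_out {X : Finset (Functional r)} [Fintype ((Fin r → ℤ) ⧸ lattice X)]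
    {η : Fin r → ℝ} (hη : ∀ l ∈ lattice X, ∃ n : ℤ, toV l ⬝ᵥ η = n)
    [Decidable (∃ v : Fin r → ℤ, η = toV v)] :
    ∑ w : (Fin r → ℤ) ⧸ lattice X, e (toV (Quotient.out w) ⬝ᵥ η) =
      if ∃ v : Fin r → ℤ, η = toV v then (Nat.card ((Fin r → ℤ) ⧸ lattice X) : ℂ) else 0 := by
  split_ifs with hv
  · obtain ⟨v, rfl⟩ := hv
    simp [toV_dotProduct_toV]
  · have hj : ∃ j, ∀ n : ℤ, η j ≠ n := by
      by_contra hcon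
      push Not at hcon
      choose v hv' using hcon
      exact hv ⟨v, funext hv'⟩
    obtain ⟨j, hj⟩ := hj
    set v₀ : Fin r → ℤ := Pi.single j 1
    have hcongr : ∀ v w : Fin r → ℤ, v - w ∈ lattice X → e (toV v ⬝ᵥ η) = e (toV w ⬝ᵥ η) := by
      intro v w hvw
      obtain ⟨n, hn⟩ := hη _ hvw
      rw [toV_sub, sub_dotProduct, sub_eq_iff_eq_add] at hn
      rw [hn, e_add, e_intCast, one_mul]
    have h1 : e (toV v₀ ⬝ᵥ η) ≠ 1 := by
      rw [dotProduct_comm, toV_dotProduct_single]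
      intro h
      obtain ⟨n, hn⟩ := (e_eq_one_iff _).1 h
      exact hj n hn
    have h2 : ∑ w : (Fin r → ℤ) ⧸ lattice X, e (toV (Quotient.out w) ⬝ᵥ η) =
        e (toV v₀ ⬝ᵥ η) * ∑ w : (Fin r → ℤ) ⧸ lattice X, e (toV (Quotient.out w) ⬝ᵥ η) := by
      rw [Finset.mul_sum, ← Equiv.sum_comp (Equiv.addLeft (Submodule.Quotient.mk v₀))]
      refine Finset.sum_congr rfl fun w _ => ?_
      rw [← e_add, ← add_dotProduct, ← toV_add]
      refine hcongr _ _ ?_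
      rw [← Submodule.Quotient.eq, mk_out, Submodule.Quotient.mk_add, mk_out]
      rfl
    by_contra h3
    exact h1 (mul_right_cancel₀ h3 (by rw [one_mul]; exact h2.symm))

namespace IsBasisOf

variable {Λ B : Finset (Functional r)}

/-- Poisson-type summation: averaging a product of trigonometric polynomials in the dual
coordinates over `ℤ^r / ⟨vec B⟩` leaves the integral frequencies. -/
theorem exists_sum_prod_trigPoly (h : IsBasisOf Λ B) [Fintype ((Fin r → ℤ) ⧸ lattice B)]
    (S : Functional r → Finset ℤ) (α : Functional r → ℤ → ℂ) :
    ∃ V : Finset (Fin r → ℤ), (∀ v, v ∈ V ↔ ∀ f ∈ B, f.1 ⬝ᵥ v ∈ S f) ∧ ∀ z : Fin r → ℝ,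
      ∑ w : (Fin r → ℤ) ⧸ lattice B, ∏ f ∈ B,
        trigPoly (S f) (α f) ((z + toV (Quotient.out w)) ⬝ᵥ dualVec B f) =
      Nat.card ((Fin r → ℤ) ⧸ lattice B) *
        ∑ v ∈ V, (∏ f ∈ B, α f (f.1 ⬝ᵥ v)) * e (z ⬝ᵥ toV v) := by
  classical
  let p : (Fin r → ℤ) → B → ℤ := fun v f => f.1.1 ⬝ᵥ v
  have hp : Function.Injective p := fun v w hvw =>
    h.injective_dotProduct fun g hg => congrFun hvw ⟨g, hg⟩
  let η : (B → ℤ) → Fin r → ℝ := fun x => ∑ f : B, (x f : ℝ) • dualVec B f.1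
  have hηp : ∀ v, η (p v) = toV v := by
    intro v
    rw [h.eq_sum_dualVec (toV v), ← Finset.sum_coe_sort B]
    refine Finset.sum_congr rfl fun f _ => ?_
    rw [toV_dotProduct_toV]
  have hfη : ∀ (x : B → ℤ) (f : B), toV f.1.1 ⬝ᵥ η x = x f := by
    intro x f
    simp only [η]
    rw [dotProduct_sum, Finset.sum_eq_single f]
    · rw [dotProduct_smul, dualVec_spec h _ f.2, if_pos rfl, smul_eq_mul, mul_one]
    · intro g _ hg
      rw [dotProduct_smul, dualVec_spec h _ f.2, if_neg fun hfg => hg (Subtype.ext hfg.symm),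
        smul_zero]
    · simp
  have hηint : ∀ x, (∃ v, η x = toV v) ↔ x ∈ Set.range p := by
    intro x
    refine ⟨fun ⟨v, hv⟩ => ⟨v, ?_⟩, fun ⟨v, hv⟩ => ⟨v, by rw [← hv, hηp]⟩⟩
    funext f
    have h1 := hfη x f
    rw [hv, toV_dotProduct_toV] at h1
    exact_mod_cast h1
  have hηlat : ∀ x, ∀ l ∈ lattice B, ∃ n : ℤ, toV l ⬝ᵥ η x = n := by
    intro x l hl
    choose n hn using fun f : B => dualVec_lattice h f.1 hl
    refine ⟨∑ f, x f * n f, ?_⟩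
    simp only [η]
    rw [dotProduct_sum]
    push_cast
    exact Finset.sum_congr rfl fun f _ => by rw [dotProduct_smul, hn, smul_eq_mul]
  refine ⟨(Fintype.piFinset fun f : B => S f.1).preimage p hp.injOn, fun v => ?_, fun z => ?_⟩
  · rw [Finset.mem_preimage, Fintype.mem_piFinset]
    exact ⟨fun hv f hf => hv ⟨f, hf⟩, fun hv f => hv f.1 f.2⟩
  set G : (B → ℤ) → ℂ := fun x => (∏ f : B, α f.1 (x f)) * e (z ⬝ᵥ η x) with hG
  have hexpand : ∀ w : (Fin r → ℤ) ⧸ lattice B, ∏ f ∈ B,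
      trigPoly (S f) (α f) ((z + toV (Quotient.out w)) ⬝ᵥ dualVec B f) =
      ∑ x ∈ Fintype.piFinset fun f : B => S f.1, G x * e (toV (Quotient.out w) ⬝ᵥ η x) := by
    intro w
    rw [← Finset.prod_coe_sort]
    simp only [trigPoly]
    rw [Finset.prod_univ_sum]
    refine Finset.sum_congr rfl fun x _ => ?_
    rw [Finset.prod_mul_distrib, hG, mul_assoc, ← e_add, ← add_dotProduct, ← e_sum]
    simp only [η]
    rw [dotProduct_sum]
    simp only [dotProduct_smul, smul_eq_mul]
  rw [Finset.sum_congr rfl fun w _ => hexpand w, Finset.sum_comm]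
  simp only [← Finset.mul_sum]
  rw [Finset.sum_congr rfl fun x _ => by rw [sum_e_out (hηlat x)]]
  simp only [hηint, mul_ite, mul_zero]
  rw [← Finset.sum_filter, ← Finset.sum_preimage' p _ hp.injOn
    fun x => G x * (Nat.card ((Fin r → ℤ) ⧸ lattice B) : ℂ), ← Finset.sum_mul, mul_comm]
  congr 1
  refine Finset.sum_congr rfl fun v _ => ?_
  rw [hG]
  simp only [hηp]
  rw [← Finset.prod_coe_sort B]

end IsBasisOf

theorem integral_e_int (m : ℤ) : ∫ x in (0 : ℝ)..1, e (m * x) = if m = 0 then 1 else 0 := by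
  split_ifs with hm
  · simp [hm]
  · have hne : (2 * Real.pi * Complex.I * ((m : ℝ) : ℂ)) ≠ 0 :=
      mul_ne_zero Complex.two_pi_I_ne_zero (by exact_mod_cast hm)
    have h := intervalIntegral.integral_eq_sub_of_hasDerivAt (a := 0) (b := 1)
      (fun x _ => hasDerivAt_e_mul m x)
      (Continuous.intervalIntegrable (by fun_prop) _ _)
    rw [intervalIntegral.integral_const_mul, mul_one, mul_zero, e_zero, e_intCast, sub_self] at h
    exact (mul_eq_zero.1 h).resolve_left hne

theorem integral_trigPoly {S : Finset ℤ} {α : ℤ → ℂ} (hα : ∀ n ∉ S, α n = 0) (n : ℤ) :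
    ∫ x in Set.Icc (0 : ℝ) 1, trigPoly S α x * e (-(n * x)) = α n := by
  rw [integral_Icc_eq_integral_Ioc, ← intervalIntegral.integral_of_le zero_le_one]
  have h1 : ∀ x : ℝ, trigPoly S α x * e (-(n * x)) =
      ∑ m ∈ S, α m * e (((m - n : ℤ) : ℝ) * x) := by
    intro x
    rw [trigPoly, Finset.sum_mul]
    refine Finset.sum_congr rfl fun m _ => ?_
    rw [mul_assoc, ← e_add]
    congr 2
    push_cast
    ring
  simp only [h1]
  rw [intervalIntegral.integral_finsetSum fun m _ =>
    Continuous.intervalIntegrable (by fun_prop) _ _]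
  simp only [intervalIntegral.integral_const_mul, integral_e_int, sub_eq_zero, mul_ite, mul_one,
    mul_zero, Finset.sum_ite_eq']
  split_ifs with hn
  · rfl
  · exact (hα n hn).symm

/-- The integrand built from trigonometric polynomials. -/
noncomputable def trigIntegrand (B L : Finset (Functional r)) (S : Functional r → Finset ℤ)
    (α : Functional r → ℤ → ℂ) (y : Fin r → ℝ) (w : Fin r → ℤ) (x : L → ℝ) : ℂ :=
  (∏ g : L, trigPoly (S g) (α g) (x g)) * ∏ f ∈ B, trigPoly (S f) (α f)
    ((y - ∑ g : L, x g • toV g.1.1 + toV w) ⬝ᵥ dualVec B f)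

@[fun_prop]
theorem continuous_trigIntegrand (B L : Finset (Functional r)) (S : Functional r → Finset ℤ)
    (α : Functional r → ℤ → ℂ) (y : Fin r → ℝ) (w : Fin r → ℤ) :
    Continuous (trigIntegrand B L S α y w) := by
  unfold trigIntegrand dotProduct
  simp only [Pi.add_apply, Pi.sub_apply, Finset.sum_apply, Pi.smul_apply, smul_eq_mul]
  fun_prop

theorem integral_prod_trigPoly (L : Finset (Functional r)) (S : Functional r → Finset ℤ)
    (α : Functional r → ℤ → ℂ) (hα : ∀ f, ∀ n ∉ S f, α f n = 0) (n : Functional r → ℤ) :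
    ∫ x in Set.Icc (0 : L → ℝ) 1, ∏ g : L, (trigPoly (S g) (α g) (x g) * e (-(n g * x g))) =
      ∏ g ∈ L, α g (n g) := by
  have h1 : Set.Icc (0 : L → ℝ) 1 = Set.univ.pi fun _ => Set.Icc (0 : ℝ) 1 :=
    (Set.pi_univ_Icc _ _).symm
  rw [h1, volume_pi, Measure.restrict_pi_pi, integral_fintype_prod_eq_prod
    (fun (g : L) (t : ℝ) => trigPoly (S g) (α g) t * e (-(n g * t))), ← Finset.prod_coe_sort L]
  exact Finset.prod_congr rfl fun g _ => integral_trigPoly (hα g) _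

theorem IsBasisOf.sum_integral_trigIntegrand {Λ B : Finset (Functional r)} (h : IsBasisOf Λ B)
    [Fintype ((Fin r → ℤ) ⧸ lattice B)] (L : Finset (Functional r)) (hBL : Disjoint B L)
    (hΛ : B ∪ L = Λ) (S : Functional r → Finset ℤ) (α : Functional r → ℤ → ℂ)
    (hα : ∀ f, ∀ n ∉ S f, α f n = 0) (y : Fin r → ℝ) :
    ∑ w : (Fin r → ℤ) ⧸ lattice B,
      ∫ x in Set.Icc (0 : L → ℝ) 1, trigIntegrand B L S α y (Quotient.out w) x =
      Nat.card ((Fin r → ℤ) ⧸ lattice B) *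
        ∑' v, e (y ⬝ᵥ toV v) * ∏ f ∈ Λ, α f (f.1 ⬝ᵥ v) := by
  obtain ⟨V, hV, hsum⟩ := h.exists_sum_prod_trigPoly S α
  have hzero : ∀ v ∉ V, e (y ⬝ᵥ toV v) * ∏ f ∈ Λ, α f (f.1 ⬝ᵥ v) = 0 := by
    intro v hv
    rw [hV] at hv
    push Not at hv
    obtain ⟨f, hf, hfS⟩ := hv
    rw [Finset.prod_eq_zero (h.subset hf) (hα f _ hfS), mul_zero]
  rw [tsum_eq_sum hzero, ← integral_finsetSum _ fun w _ =>
    (continuous_trigIntegrand B L S α y _).continuousOn.integrableOn_compact isCompact_Icc]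
  have hint : ∀ x : L → ℝ, ∑ w : (Fin r → ℤ) ⧸ lattice B,
      trigIntegrand B L S α y (Quotient.out w) x =
      ∑ v ∈ V, (Nat.card ((Fin r → ℤ) ⧸ lattice B) * (∏ f ∈ B, α f (f.1 ⬝ᵥ v)) *
        e (y ⬝ᵥ toV v)) * ∏ g : L, (trigPoly (S g) (α g) (x g) *
          e (-(((g.1.1 ⬝ᵥ v : ℤ) : ℝ) * x g))) := by
    intro x
    simp only [trigIntegrand]
    rw [← Finset.mul_sum, hsum, Finset.mul_sum, Finset.mul_sum]
    refine Finset.sum_congr rfl fun v _ => ?_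
    have h1 : e ((y - ∑ g : L, x g • toV g.1.1) ⬝ᵥ toV v) =
        e (y ⬝ᵥ toV v) * ∏ g : L, e (-(((g.1.1 ⬝ᵥ v : ℤ) : ℝ) * x g)) := by
      rw [← e_sum, ← e_add, sub_dotProduct, sum_dotProduct, sub_eq_add_neg,
        ← Finset.sum_neg_distrib]
      congr 2
      refine Finset.sum_congr rfl fun g _ => ?_
      rw [smul_dotProduct, toV_dotProduct_toV, smul_eq_mul, mul_comm]
    rw [h1, Finset.prod_mul_distrib]
    ring
  simp only [hint]
  rw [integral_finsetSum, Finset.mul_sum]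
  · refine Finset.sum_congr rfl fun v _ => ?_
    rw [integral_const_mul, integral_prod_trigPoly L S α hα fun f => f.1 ⬝ᵥ v, ← hΛ,
      Finset.prod_union hBL]
    ring
  · intro v _
    exact (Continuous.continuousOn (by fun_prop)).integrableOn_compact isCompact_Icc

/-- A nonconstant affine functional is almost everywhere non-integral. -/
theorem ae_forall_add_sum_ne_int {ι : Type*} [Fintype ι] {c : ι → ℝ} {i : ι} (hc : c i ≠ 0)
    (t : ℝ) : ∀ᵐ x : ι → ℝ, ∀ n : ℤ, t + ∑ j, x j * c j ≠ n := by
  classical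
  rw [ae_all_iff]
  intro n
  let ℓ : (ι → ℝ) →ₗ[ℝ] ℝ := ∑ j, c j • LinearMap.proj j
  have hℓ : ∀ x, ℓ x = ∑ j, x j * c j := by
    intro x
    simp [ℓ, mul_comm]
  let x₀ : ι → ℝ := Pi.single i ((n - t) / c i)
  have hx₀ : ℓ x₀ = n - t := by
    rw [hℓ, Finset.sum_eq_single i (fun j _ hj => by simp [x₀, hj]) (by simp)]
    simp [x₀, hc]
  have hker : AffineSubspace.mk' x₀ (LinearMap.ker ℓ) ≠ ⊤ := by
    intro htop
    have h1 : Pi.single i 1 + x₀ ∈ AffineSubspace.mk' x₀ (LinearMap.ker ℓ) := by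
      rw [htop]; trivial
    rw [AffineSubspace.mem_mk', vsub_eq_sub, add_sub_cancel_right, LinearMap.mem_ker, hℓ,
      Finset.sum_eq_single i (fun j _ hj => by simp [hj]) (by simp)] at h1
    simp [hc] at h1
  rw [ae_iff]
  refine measure_mono_null (fun x hx => ?_) (Measure.addHaar_affineSubspace volume _ hker)
  have hx' : t + ∑ j, x j * c j = n := not_not.1 hx
  change x ∈ AffineSubspace.mk' x₀ (LinearMap.ker ℓ)
  rw [AffineSubspace.mem_mk', vsub_eq_sub, LinearMap.mem_ker, map_sub, hx₀, hℓ]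
  linarith

/-- The integrand built from functions `ψ f` evaluated at the dual coordinates. -/
noncomputable def dualIntegrand (B L : Finset (Functional r)) (ψ : Functional r → ℝ → ℂ)
    (y : Fin r → ℝ) (w : Fin r → ℤ) (x : L → ℝ) : ℂ :=
  (∏ g : L, ψ g (x g)) * ∏ f ∈ B, ψ f
    ((y - ∑ g : L, x g • toV g.1.1 + toV w) ⬝ᵥ dualVec B f)

theorem IsBasisOf.sum_integral_dualIntegrand {Λ B : Finset (Functional r)} (h : IsBasisOf Λ B)
    [Fintype ((Fin r → ℤ) ⧸ lattice B)] (L : Finset (Functional r)) (hBL : Disjoint B L)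
    (hΛ : B ∪ L = Λ) {D : Functional r → ℤ → ℝ} {a : Functional r → ℤ → ℂ}
    {ψ : Functional r → ℝ → ℂ} {E : Functional r → Set ℝ}
    (happrox : ∀ f, FourierApprox (D f) (a f) (ψ f) (E f))
    (hD : Summable fun v : Fin r → ℤ => ∏ f ∈ Λ, D f (f.1 ⬝ᵥ v)) (y : Fin r → ℝ)
    (hae : ∀ w : Fin r → ℤ, ∀ᵐ x : L → ℝ, (∀ g : L, x g ∉ E g) ∧
      ∀ f ∈ B, (y - ∑ g : L, x g • toV g.1.1 + toV w) ⬝ᵥ dualVec B f ∉ E f) :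
    ∑ w : (Fin r → ℤ) ⧸ lattice B,
      ∫ x in Set.Icc (0 : L → ℝ) 1, dualIntegrand B L ψ y (Quotient.out w) x =
      Nat.card ((Fin r → ℤ) ⧸ lattice B) *
        ∑' v, e (y ⬝ᵥ toV v) * ∏ f ∈ Λ, a f (f.1 ⬝ᵥ v) := by
  choose α S K hα hαD hαa hK hψ using happrox
  have hleft : Tendsto (fun M => ∑ w : (Fin r → ℤ) ⧸ lattice B, ∫ x in Set.Icc (0 : L → ℝ) 1,
      trigIntegrand B L (fun f => S f M) (fun f => α f M) y (Quotient.out w) x) atTop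
      (𝓝 (∑ w : (Fin r → ℤ) ⧸ lattice B,
        ∫ x in Set.Icc (0 : L → ℝ) 1, dualIntegrand B L ψ y (Quotient.out w) x)) := by
    refine tendsto_finsetSum _ fun w _ => ?_
    refine tendsto_integral_of_dominated_convergence
      (fun _ => (∏ g : L, K g) * ∏ f ∈ B, K f)
      (fun M => (continuous_trigIntegrand B L _ _ y _).aestronglyMeasurable)
      (integrableOn_const isCompact_Icc.measure_lt_top.ne) (fun M => ?_) ?_
    · refine Eventually.of_forall fun x => ?_
      rw [trigIntegrand, norm_mul, norm_prod, norm_prod]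
      exact mul_le_mul (Finset.prod_le_prod (fun _ _ => norm_nonneg _) fun g _ => hK g.1 M _)
        (Finset.prod_le_prod (fun _ _ => norm_nonneg _) fun f _ => hK f M _)
        (Finset.prod_nonneg fun _ _ => norm_nonneg _)
        (Finset.prod_nonneg fun g _ => (norm_nonneg _).trans (hK g.1 0 0))
    · refine ae_restrict_of_ae ?_
      filter_upwards [hae (Quotient.out w)] with x hx
      exact (tendsto_finsetProd _ fun g _ => hψ g.1 _ (hx.1 g)).mul
        (tendsto_finsetProd _ fun f hf => hψ f _ (hx.2 f hf))
  have hright : Tendsto (fun M => (Nat.card ((Fin r → ℤ) ⧸ lattice B) : ℂ) *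
      ∑' v, e (y ⬝ᵥ toV v) * ∏ f ∈ Λ, α f M (f.1 ⬝ᵥ v)) atTop
      (𝓝 (Nat.card ((Fin r → ℤ) ⧸ lattice B) *
        ∑' v, e (y ⬝ᵥ toV v) * ∏ f ∈ Λ, a f (f.1 ⬝ᵥ v))) := by
    refine Tendsto.const_mul _ (tendsto_tsum_of_dominated_convergence hD (fun v => ?_)
      (Eventually.of_forall fun M v => ?_))
    · exact Tendsto.const_mul _ (tendsto_finsetProd _ fun f _ => hαa f _)
    · rw [norm_mul, norm_e, one_mul, norm_prod]
      exact Finset.prod_le_prod (fun _ _ => norm_nonneg _) fun f _ => hαD f M _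
  refine tendsto_nhds_unique hleft (hright.congr fun M => ?_)
  exact (h.sum_integral_trigIntegrand L hBL hΛ _ _ (fun f => hα f M) y).symm

theorem fracCoset_eq {Λ B : Finset (Functional r)} (h : IsBasisOf Λ B) (φ : Fin r → ℝ)
    (f : Functional r) (y : Fin r → ℝ) (w : (Fin r → ℤ) ⧸ lattice B) :
    fracCoset h φ f y w = frac φ B f (y + toV (Quotient.out w)) := by
  conv_lhs => rw [← mk_out w]
  rfl

theorem frac_mem_Icc (φ : Fin r → ℝ) (B : Finset (Functional r)) (f : Functional r)
    (z : Fin r → ℝ) : frac φ B f z ∈ Set.Icc (0 : ℝ) 1 := by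
  have h1 := fract_mem_Icc (z ⬝ᵥ dualVec B f)
  have h2 := fract_mem_Icc (-(z ⬝ᵥ dualVec B f))
  unfold frac
  split_ifs
  · exact h1
  · exact ⟨by linarith [h2.2], by linarith [h2.1]⟩

theorem fract_ne_zero_of_not_int {x : ℝ} (hx : ¬ ∃ n : ℤ, x = n) : Int.fract x ≠ 0 := by
  intro h
  obtain ⟨n, hn⟩ := Int.fract_eq_zero_iff.1 h
  exact hx ⟨n, hn.symm⟩

theorem frac_eq_fract (φ : Fin r → ℝ) (B : Finset (Functional r)) (f : Functional r)
    {z : Fin r → ℝ} (hz : ¬ ∃ n : ℤ, z ⬝ᵥ dualVec B f = n) :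
    frac φ B f z = Int.fract (z ⬝ᵥ dualVec B f) := by
  unfold frac
  split_ifs
  · rfl
  · rw [Int.fract_neg (fract_ne_zero_of_not_int hz)]
    ring

theorem C_frac_eq {k : ℕ} (hk : k ≠ 1) (b : ℂ) (φ : Fin r → ℝ) (B : Finset (Functional r))
    (f : Functional r) (z : Fin r → ℝ) :
    C k (frac φ B f z) b = C k (Int.fract (z ⬝ᵥ dualVec B f)) b := by
  by_cases hz : ∃ n : ℤ, z ⬝ᵥ dualVec B f = n
  · obtain ⟨n, hn⟩ := hz
    have h1 := C_one_sub_C_zero k b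
    rw [if_neg hk, sub_eq_zero] at h1
    unfold frac
    rw [hn, Int.fract_intCast, ← Int.cast_neg, Int.fract_intCast]
    split_ifs
    · rfl
    · rw [sub_zero, h1]
  · rw [frac_eq_fract φ B f hz]

theorem measurable_frac (φ : Fin r → ℝ) (B : Finset (Functional r)) (f : Functional r) :
    Measurable (frac φ B f) := by
  have h1 : Measurable fun z : Fin r → ℝ => z ⬝ᵥ dualVec B f := by
    unfold dotProduct
    fun_prop
  unfold frac
  split_ifs
  · exact h1.fract
  · exact measurable_const.sub h1.neg.fract

theorem integrableOn_integrand {Λ B : Finset (Functional r)} (h : IsBasisOf Λ B)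
    (L : Finset (Functional r)) (φ : Fin r → ℝ) (k : Functional r → ℕ) (y : Fin r → ℝ)
    (w : (Fin r → ℤ) ⧸ lattice B) :
    IntegrableOn (integrand h L φ k y w) (Set.Icc 0 1) volume := by
  choose K hK using fun f : Functional r => exists_norm_fract_le (continuous_C (k f) f.2)
  have hmeas : Measurable (integrand h L φ k y w) := by
    unfold integrand
    simp only [fracCoset_eq]
    refine Measurable.mul ?_ ?_
    · exact Finset.measurable_prod _ fun g _ =>
        (continuous_C (k g) g.1.2).measurable.comp (measurable_pi_apply g)
    · refine Finset.measurable_prod _ fun f _ =>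
        (continuous_C (k f) f.2).measurable.comp ((measurable_frac φ B f).comp ?_)
      fun_prop
  refine Measure.integrableOn_of_bounded (M := (∏ g : L, K g) * ∏ f ∈ B, K f)
    isCompact_Icc.measure_lt_top.ne hmeas.aestronglyMeasurable ?_
  refine (ae_restrict_iff' measurableSet_Icc).2 (Eventually.of_forall fun x hx => ?_)
  rw [integrand, norm_mul, norm_prod, norm_prod]
  refine mul_le_mul (Finset.prod_le_prod (fun _ _ => norm_nonneg _) fun g _ =>
      hK g.1 _ ⟨hx.1 g, hx.2 g⟩)
    (Finset.prod_le_prod (fun _ _ => norm_nonneg _) fun f _ => ?_)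
    (Finset.prod_nonneg fun _ _ => norm_nonneg _)
    (Finset.prod_nonneg fun g _ => (norm_nonneg _).trans (hK g.1 0 (by simp)))
  rw [fracCoset_eq]
  exact hK f _ (frac_mem_Icc _ _ _ _)

open Classical in
/-- The periodic function whose Fourier coefficients are `diffCoeff`. -/
noncomputable def diffFun (k : Functional r → ℕ) (d : Functional r → ℤ)
    (I : Finset (Functional r)) (f : Functional r) (x : ℝ) : ℂ :=
  (if f ∈ I then 1 - e (d f * x) else 1) * normC (k f) f.2 (Int.fract x)

theorem exists_fourierApprox_diffFun {k : Functional r → ℕ} (d : Functional r → ℤ)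
    {I : Finset (Functional r)} (hI : ∀ f ∈ I, k f = 1) (f : Functional r) :
    ∃ K : ℝ, FourierApprox (fun n => K * decay n ^ (if k f = 1 ∧ f ∉ I then 1 else 2))
      (diffCoeff (fun f => coeff (k f) f.2) d I f) (diffFun k d I f)
      (if k f = 1 ∧ f ∉ I then {x | ∃ n : ℤ, x = n} else ∅) := by
  by_cases hf : f ∈ I
  · obtain ⟨K, hK⟩ := fourierApprox_one_sub_mul_normC_one f.2 (d f)
    have h1 : diffCoeff (fun f => coeff (k f) f.2) d I f =
        fun n => coeff 1 f.2 n - coeff 1 f.2 (n - d f) :=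
      funext fun n => by simp [diffCoeff, hf, hI f hf]
    have h2 : diffFun k d I f = fun x => (1 - e (d f * x)) * normC 1 f.2 (Int.fract x) :=
      funext fun x => by simp [diffFun, hf, hI f hf]
    exact ⟨K, by simpa [h1, h2, hf] using hK⟩
  · have h1 : diffCoeff (fun f => coeff (k f) f.2) d I f = coeff (k f) f.2 :=
      funext fun n => by simp [diffCoeff, hf]
    have h2 : diffFun k d I f = fun x => normC (k f) f.2 (Int.fract x) :=
      funext fun x => by simp [diffFun, hf]
    by_cases hk : k f = 1
    · obtain ⟨K, hK⟩ := fourierApprox_normC_one f.2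
      exact ⟨K, by simpa [h1, h2, hf, hk] using hK⟩
    · obtain ⟨K, hK⟩ := fourierApprox_normC_of_ne_one hk f.2
      exact ⟨K, by simpa [h1, h2, hf, hk] using hK⟩

/-- The indispensable functionals with exponent `1`. -/
noncomputable def simpleIndispensable (Λ : Finset (Functional r)) (k : Functional r → ℕ) :
    Finset (Functional r) := (indispensable Λ).filter fun f => k f = 1

namespace IsBasisOf

variable {Λ B L : Finset (Functional r)}

/-- Dual coordinates of almost every translate avoid the integers, for the dispensable
functionals. -/
theorem ae_dual_coordinate_not_int (h : IsBasisOf Λ B) (hΛ : B ∪ L = Λ) (y : Fin r → ℝ)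
    (w : Fin r → ℤ) :
    ∀ᵐ x : L → ℝ, (∀ g : L, ¬ ∃ n : ℤ, x g = n) ∧ ∀ f ∈ B, f ∉ indispensable Λ →
      ¬ ∃ n : ℤ, (y - ∑ g : L, x g • toV g.1.1 + toV w) ⬝ᵥ dualVec B f = n := by
  refine eventually_and.2 ⟨ae_all_iff.2 fun g => ?_, ?_⟩
  · classical
    filter_upwards [ae_forall_add_sum_ne_int (c := Pi.single g (1 : ℝ)) (i := g) (by simp) 0]
      with x hx hn
    obtain ⟨n, hn⟩ := hn
    refine hx n ?_
    rw [zero_add, Finset.sum_eq_single g (fun j _ hj => by simp [hj]) (by simp)]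
    simpa using hn
  · rw [eventually_all_finset]
    intro f hf
    by_cases hind : f ∈ indispensable Λ
    · exact Eventually.of_forall fun _ h => absurd hind h
    obtain ⟨g, hg, hgB, hgf⟩ := h.exists_dotProduct_dualVec_ne_zero hf hind
    have hgL : g ∈ L := by
      rw [← hΛ] at hg
      exact (Finset.mem_union.1 hg).resolve_left hgB
    filter_upwards [ae_forall_add_sum_ne_int (c := fun g : L => -(toV g.1.1 ⬝ᵥ dualVec B f))
      (i := ⟨g, hgL⟩) (neg_ne_zero.2 hgf) ((y + toV w) ⬝ᵥ dualVec B f)] with x hx _ hn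
    obtain ⟨n, hn⟩ := hn
    refine hx n ?_
    rw [← hn, sub_add_eq_add_sub, sub_dotProduct, sum_dotProduct, sub_eq_add_neg]
    simp [smul_dotProduct]

variable {k : Functional r → ℕ} {y : Fin r → ℝ} {u : Functional r → Fin r → ℤ}
  {d : Functional r → ℤ}

/-- Off a null set, the integrand of the evaluation formula is a multiple of the integrand built
from the functions `diffFun`. -/
theorem dualIntegrand_diffFun_eq (h : IsBasisOf Λ B) (hBL : Disjoint B L) (hΛ : B ∪ L = Λ)
    (φ : Fin r → ℝ)
    (hu : ∀ f ∈ simpleIndispensable Λ k, toV (u f) = (d f : ℝ) • dualVec B f ∧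
      (∀ g ∈ Λ, g ≠ f → g.1 ⬝ᵥ u f = 0) ∧ e (y ⬝ᵥ toV (u f)) ≠ 1)
    (w : (Fin r → ℤ) ⧸ lattice B) {x : L → ℝ} (hx01 : x ∈ Set.Icc (0 : L → ℝ) 1)
    (hx1 : ∀ g : L, ¬ ∃ n : ℤ, x g = n)
    (hx2 : ∀ f ∈ B, f ∉ indispensable Λ →
      ¬ ∃ n : ℤ, (y - ∑ g : L, x g • toV g.1.1 + toV (Quotient.out w)) ⬝ᵥ dualVec B f = n) :
    dualIntegrand B L (diffFun k d (simpleIndispensable Λ k)) y (Quotient.out w) x =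
      (∏ f ∈ Λ, normFactor (k f)) * (∏ f ∈ simpleIndispensable Λ k, (1 - e (y ⬝ᵥ toV (u f)))) *
        integrand h L φ k y w x := by
  classical
  set I := simpleIndispensable Λ k with hI
  have hIB : I ⊆ B := fun f hf => h.mem_of_indispensable (Finset.mem_filter.1 hf).1
  have hL : ∀ g : L, diffFun k d I g (x g) = normFactor (k g) * C (k g) (x g) g.1.2 := by
    intro g
    have hgI : g.1 ∉ I := fun hg => Finset.disjoint_left.1 hBL (hIB hg) g.2
    have hfr : Int.fract (x g) = x g := by
      refine Int.fract_eq_self.2 ⟨hx01.1 g, lt_of_le_of_ne (hx01.2 g) fun h1 => hx1 g ⟨1, ?_⟩⟩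
      simpa using h1
    rw [diffFun, if_neg hgI, one_mul, hfr, normC]
  have hB : ∀ f ∈ B, diffFun k d I f
      ((y - ∑ g : L, x g • toV g.1.1 + toV (Quotient.out w)) ⬝ᵥ dualVec B f) =
      normFactor (k f) * (if f ∈ I then 1 - e (y ⬝ᵥ toV (u f)) else 1) *
        C (k f) (fracCoset h φ f (y - ∑ g : L, x g • toV g.1.1) w) f.2 := by
    intro f hf
    rw [fracCoset_eq, diffFun, normC]
    set z := y - ∑ g : L, x g • toV g.1.1 + toV (Quotient.out w) with hz
    by_cases hfI : f ∈ I
    · obtain ⟨hu1, hu2, hu3⟩ := hu f hfI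
      have he : e (d f * (z ⬝ᵥ dualVec B f)) = e (y ⬝ᵥ toV (u f)) := by
        have h1 : d f * (z ⬝ᵥ dualVec B f) = z ⬝ᵥ toV (u f) := by
          rw [hu1, dotProduct_smul, smul_eq_mul]
        have h2 : (∑ g : L, x g • toV g.1.1) ⬝ᵥ toV (u f) = 0 := by
          rw [sum_dotProduct]
          refine Finset.sum_eq_zero fun g _ => ?_
          have hgΛ : g.1 ∈ Λ := by rw [← hΛ]; exact Finset.mem_union_right _ g.2
          have hgf : g.1 ≠ f := fun hgf =>
            Finset.disjoint_left.1 hBL hf (hgf ▸ g.2)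
          rw [smul_dotProduct, toV_dotProduct_toV, hu2 g.1 hgΛ hgf, Int.cast_zero, smul_zero]
        rw [h1, hz, add_dotProduct, sub_dotProduct, h2, sub_zero, toV_dotProduct_toV, e_add,
          e_intCast, mul_one]
      have hzn : ¬ ∃ n : ℤ, z ⬝ᵥ dualVec B f = n := by
        rintro ⟨n, hn⟩
        rw [hn, ← Int.cast_mul, e_intCast] at he
        exact hu3 he.symm
      rw [if_pos hfI, if_pos hfI, he, frac_eq_fract φ B f hzn]
      ring
    · rw [if_neg hfI, if_neg hfI, one_mul, mul_one]
      by_cases hk : k f = 1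
      · rw [frac_eq_fract φ B f (hx2 f hf fun hind => hfI (Finset.mem_filter.2 ⟨hind, hk⟩))]
      · rw [C_frac_eq hk]
  have hΛprod : ∏ f ∈ Λ, normFactor (k f) =
      (∏ f ∈ B, normFactor (k f)) * ∏ f ∈ L, normFactor (k f) := by
    rw [← hΛ, Finset.prod_union hBL]
  rw [dualIntegrand, integrand, Finset.prod_congr rfl fun g _ => hL g, Finset.prod_congr rfl hB,
    Finset.prod_mul_distrib, Finset.prod_mul_distrib, Finset.prod_mul_distrib,
    Finset.prod_ite_mem, Finset.inter_eq_right.2 hIB,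
    Finset.prod_coe_sort L fun g => normFactor (k g), hΛprod]
  ring

/-- The truncated sums converge to the right-hand side of the evaluation formula. -/
theorem tendsto_Z (hr : 0 < r) (h : IsBasisOf Λ B) (hBL : Disjoint B L) (hΛ : B ∪ L = Λ)
    (k : Functional r → ℕ) (y : Fin r → ℝ)
    (hy : y ∉ ⋃ f ∈ (indispensable Λ).filter (fun f => k f = 1), realSpanTranslates (Λ.erase f))
    (φ : Fin r → ℝ) :
    Tendsto (Z Λ k y) atTop (𝓝 (1 / (Nat.card ((Fin r → ℤ) ⧸ lattice B) : ℂ) *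
      (∏ f ∈ Λ, normFactor (k f)) * ∑ᶠ w : (Fin r → ℤ) ⧸ lattice B,
        ∫ x in Set.Icc (0 : L → ℝ) 1, integrand h L φ k y w x)) := by
  classical
  have := h.finite_quotient
  have := Fintype.ofFinite ((Fin r → ℤ) ⧸ lattice B)
  set I := simpleIndispensable Λ k with hI
  have hIind : ∀ f ∈ I, f ∈ indispensable Λ := fun f hf => (Finset.mem_filter.1 hf).1
  have hIk : ∀ f ∈ I, k f = 1 := fun f hf => (Finset.mem_filter.1 hf).2
  have hIΛ : I ⊆ Λ := fun f hf => h.subset (h.mem_of_indispensable (hIind f hf))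
  have hex : ∀ f, ∃ (u : Fin r → ℤ) (d : ℤ), f ∈ I → toV u = (d : ℝ) • dualVec B f ∧
      (∀ g ∈ Λ, g ≠ f → g.1 ⬝ᵥ u = 0) ∧ f.1 ⬝ᵥ u = d ∧ e (y ⬝ᵥ toV u) ≠ 1 := by
    intro f
    by_cases hf : f ∈ I
    · obtain ⟨u, d, hu⟩ := h.exists_primitive_dual (hIind f hf) (y := y) fun hyf =>
        hy (Set.mem_biUnion (t := fun f => realSpanTranslates (Λ.erase f)) hf hyf)
      exact ⟨u, d, fun _ => hu⟩
    · exact ⟨0, 0, fun hf' => absurd hf' hf⟩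
  choose u d hud using hex
  set a : Functional r → ℤ → ℂ := fun f => coeff (k f) f.2 with ha
  set P : ℂ := ∏ f ∈ I, (1 - e (y ⬝ᵥ toV (u f))) with hP
  have hP0 : P ≠ 0 := Finset.prod_ne_zero_iff.2 fun f hf => sub_ne_zero.2 (hud f hf).2.2.2.symm
  choose K hK using fun f => exists_fourierApprox_diffFun d hIk f
  set p : Functional r → ℕ := fun f => if k f = 1 ∧ f ∉ I then 1 else 2 with hp
  have hsum : Summable fun v : Fin r → ℤ => ∏ f ∈ Λ, (K f * decay (f.1 ⬝ᵥ v) ^ p f) := by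
    simp only [Finset.prod_mul_distrib]
    refine (summable_prod_decay hr h.latticeRank_eq p (fun f _ => ?_) fun f hf => ?_).mul_left _
    · simp only [hp]
      split_ifs <;> omega
    · simp only [hp]
      rw [if_neg]
      exact fun hk => hk.2 (Finset.mem_filter.2 ⟨hf, hk.1⟩)
  set A : (Fin r → ℤ) → ℂ := fun v => ∏ f ∈ Λ, diffCoeff a d I f (f.1 ⬝ᵥ v) with hA
  have hAsum : Summable fun v => ‖A v‖ := by
    refine hsum.of_nonneg_of_le (fun _ => norm_nonneg _) fun v => ?_
    rw [hA, norm_prod]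
    refine Finset.prod_le_prod (fun _ _ => norm_nonneg _) fun f _ => ?_
    obtain ⟨α, S, K', -, h2, h3, -⟩ := hK f
    exact le_of_tendsto (h3 _).norm (Eventually.of_forall fun M => h2 M _)
  have hlim := (h.tendsto_prod_mul_cubeSum_sub a d hIΛ (fun f => norm_coeff_le (k f) f.2) u
    (fun f hf => (hud f hf).2.1) (fun f hf => (hud f hf).2.2.1) y).add
    (tendsto_cubeSum_of_summable hAsum y)
  rw [zero_add] at hlim
  have hZ : Tendsto (Z Λ k y) atTop (𝓝 (P⁻¹ * ∑' v, e (y ⬝ᵥ toV v) * A v)) := by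
    refine (hlim.const_mul P⁻¹).congr fun N => ?_
    change P⁻¹ * (P * cubeSum (fun v => ∏ f ∈ Λ, a f (f.1 ⬝ᵥ v)) y N - cubeSum A y N +
      cubeSum A y N) = _
    rw [sub_add_cancel, inv_mul_cancel_left₀ hP0, Z_eq_cubeSum]
  convert hZ using 2
  have hident := h.sum_integral_dualIntegrand L hBL hΛ hK hsum y fun w => by
    filter_upwards [h.ae_dual_coordinate_not_int hΛ y w] with x hx
    refine ⟨fun g => ?_, fun f hf => ?_⟩
    · split_ifs
      · exact hx.1 g
      · exact Set.notMem_empty _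
    · split_ifs with hkf
      · exact hx.2 f hf fun hind => hkf.2 (Finset.mem_filter.2 ⟨hind, hkf.1⟩)
      · exact Set.notMem_empty _
  have hcongr : ∀ w : (Fin r → ℤ) ⧸ lattice B, ∫ x in Set.Icc (0 : L → ℝ) 1,
      dualIntegrand B L (diffFun k d I) y (Quotient.out w) x =
      (∏ f ∈ Λ, normFactor (k f)) * P *
        ∫ x in Set.Icc (0 : L → ℝ) 1, integrand h L φ k y w x := by
    intro w
    rw [← integral_const_mul]
    refine integral_congr_ae ((ae_restrict_iff' measurableSet_Icc).2 ?_)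
    filter_upwards [h.ae_dual_coordinate_not_int hΛ y (Quotient.out w)] with x hx hx01
    exact h.dualIntegrand_diffFun_eq hBL hΛ φ
      (fun f hf => ⟨(hud f hf).1, (hud f hf).2.1, (hud f hf).2.2.2⟩) w hx01 hx.1 hx.2
  rw [Finset.sum_congr rfl fun w _ => hcongr w, ← Finset.mul_sum] at hident
  have hcard : (Nat.card ((Fin r → ℤ) ⧸ lattice B) : ℂ) ≠ 0 := by
    exact_mod_cast Nat.card_pos.ne'
  rw [finsum_eq_sum_of_fintype, eq_inv_mul_iff_mul_eq₀ hP0, ← mul_right_inj' hcard]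
  refine Eq.trans ?_ hident
  field_simp

end IsBasisOf

end LatticeSum

theorem mainTheorem4 (r : ℕ) (hr : 0 < r)
    (Λ : Finset (LatticeSum.Functional r))
    (hΛ0 : ∀ f ∈ Λ, f.1 ≠ 0)
    (hΛr : LatticeSum.latticeRank Λ = r)
    (k : LatticeSum.Functional r → ℕ)
    (y : Fin r → ℝ)
    (hy : y ∉ ⋃ f ∈ (LatticeSum.indispensable Λ).filter (fun f => k f = 1),
      LatticeSum.realSpanTranslates (Λ.erase f)) :
    (∃ s : ℂ, Tendsto (LatticeSum.Z Λ k y) atTop (𝓝 s)) ∧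
    ∀ φ : Fin r → ℝ,
      (∀ R : Finset (LatticeSum.Functional r), LatticeSum.IsIndepOfCorank1 Λ R →
        φ ∉ LatticeSum.realSpan R) →
      ∀ (B₀ L₀ : Finset (LatticeSum.Functional r)) (hB₀ : LatticeSum.IsBasisOf Λ B₀),
        Disjoint B₀ L₀ → B₀ ∪ L₀ = Λ →
        (∀ w : (Fin r → ℤ) ⧸ LatticeSum.lattice B₀,
          IntegrableOn (LatticeSum.integrand hB₀ L₀ φ k y w) (Set.Icc 0 1) volume) ∧
        LatticeSum.S Λ k y =
          1 / (Nat.card ((Fin r → ℤ) ⧸ LatticeSum.lattice B₀) : ℂ) *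
          (∏ f ∈ Λ, (-((2 * Real.pi * Complex.I) ^ k f / ((k f).factorial : ℂ)))) *
          ∑ᶠ w : (Fin r → ℤ) ⧸ LatticeSum.lattice B₀,
            ∫ x in Set.Icc (0 : L₀ → ℝ) 1, LatticeSum.integrand hB₀ L₀ φ k y w x := by
  refine ⟨?_, fun φ _ B₀ L₀ hB₀ hdisj hunion =>
    ⟨fun w => LatticeSum.integrableOn_integrand hB₀ L₀ φ k y w,
      (hB₀.tendsto_Z hr hdisj hunion k y hy φ).limUnder_eq⟩⟩
  obtain ⟨B, hB⟩ := LatticeSum.exists_isBasisOf hΛr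
  exact ⟨_, hB.tendsto_Z hr Finset.disjoint_sdiff (Finset.union_sdiff_of_subset hB.subset) k y hy 0⟩
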